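/- **Setting.** Let $(E,d)$ be a complete geodesic metric space and let $\mathcal E:E\to(-\infty,+\infty]$ be lower semicontinuous and not identically $+\infty$. Let a topology on $E$, called weak and coarser than the metric topology, be given such that $d$ is weakly lower semicontinuous on $E\times E$, $\mathcal E$ is weakly lower semicontinuous on every metric ball, and $\{\pi: d(\rho,\pi)\le r,\ \mathcal E(\pi)\le s\}$ is weakly compact for all $\rho\in E$, $r,s\in\mathbb R$. Let $\kappa\in\mathbb R$ and assume that $\mathcal E$ has an $EVI_\kappa$ gradient flow on $E$: continuous maps $\mu\mapsto\mu(t)$, $t\ge0$, from $E$ to $E$ with the semigroup property and $\mu(0)=\mu$, such that each curve $t\mapsto\mu(t)$ is continuous on $[0,\infty)$, has $\mathcal E(\mu(t))<\infty$ for $t>0$, and satisfies, for all $t\ge 0$ and all $\rho$ with $\mathcal E(\rho)<\infty$, $$\tfrac12\tfrac{\mathrm d^+}{\mathrm dt}d^2(\mu(t),\rho)\le\mathcal E(\rho)-\mathcal E(\mu(t))-\tfrac\kappa2d^2(\mu(t),\rho),$$ where $\frac{\mathrm d^+}{\mathrm dt}$ is the upper right derivative. Let $I(\pi)=|\partial\mathcal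 E|^2(\pi)$ be the squared local slope, where $|\partial\mathcal E|(\pi)=\limsup_{\rho\to\pi}\frac{(\mathcal E(\pi)-\mathcal E(\rho))^+}{d(\pi,\rho)}$, with $I(\pi)=+\infty$ if $\mathcal E(\pi)=+\infty$. Put $\hat\kappa=0\wedge\kappa$ and, for $\varepsilon>0$, $\psi_\varepsilon(r)=\sqrt{2\varepsilon}+\frac{r-\varepsilon}{\sqrt{2\varepsilon}}-\frac{(r-\varepsilon)^2}{2(2\varepsilon)^{3/2}}$ for $0\le r\le\varepsilon$ and $\psi_\varepsilon(r)=\sqrt{2r}$ for $r>\varepsilon$. Set $$d_\varepsilon(\pi,\mu)=\psi_\varepsilon(\tfrac12d^2(\pi,\mu)),\quad h^\varepsilon_{\pi,\mu}(t)=e^{\hat\kappa t}d_\varepsilon(\pi,\mu(t)),\quad d_{T,\varepsilon}(\pi,\mu)=\inf_{t\ge0}\{t+h^\varepsilon_{\pi,\mu}(t)\},$$ $$\Xi(\pi,\mu)=\operatorname*{argmin}_{t\ge0}\{t+h^\varepsilon_{\pi,\mu}(t)\},\quad \lambda_{m}(\mathrm dt)=\mathbf 1_{t\ge0}\,m e^{-mt}\mathrm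 dt,\quad \Lambda_{\varepsilon,m}(\pi,\mu)=\int e^{-mh^\varepsilon_{\pi,\mu}(t)}\lambda_{m+1}(\mathrm dt).$$ **Hamiltonians.** Abbreviate $$B_{\varepsilon,m}(\pi,\mu)=\Lambda_{\varepsilon,m}(\pi,\mu)^{-1}\int e^{-mh^\varepsilon_{\pi,\mu}(t)}\Big\{\psi_\varepsilon'(\tfrac12d^2(\pi,\mu(t)))e^{\hat\kappa t}[\mathcal E(\mu(t))-\mathcal E(\pi)]-\tfrac{\hat\kappa}2\big(\tfrac1m\vee h^\varepsilon_{\pi,\mu}(t)\big)\Big\}\lambda_{m+1}(\mathrm dt),$$ $$B_{\varepsilon}(\pi,\mu)=\sup_{t\in\Xi(\pi,\mu)}\Big\{e^{\hat\kappa t}[\mathcal E(\mu(t))-\mathcal E(\pi)]\psi_\varepsilon'(\tfrac12d^2(\pi,\mu(t)))-\tfrac{\hat\kappa}2e^{\hat\kappa t}d_\varepsilon(\pi,\mu(t))\Big\}.$$ Let $a,b,\varepsilon$ range over $(0,\infty)$, $c$ over $\mathbb R$, $m$ over the integers $\ge1$. For $\rho,\mu$ with $I(\rho)+I(\mu)<\infty$,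 put $$G^\dagger(\pi)=a[\mathcal E(\rho)-\mathcal E(\pi)]-\tfrac{a\kappa}2d^2(\pi,\rho)+\tfrac{a^2}2d^2(\pi,\rho)+ab\,d(\pi,\rho)+\tfrac{b^2}2.$$ $H_{3,\dagger}$ is the set of all pairs $(f,g)$ with $f(\pi)=\frac a2d^2(\pi,\rho)-\frac bm\log\Lambda_{\varepsilon,m}(\pi,\mu)+c$ and $g(\pi)=G^\dagger(\pi)+b\,B_{\varepsilon,m}(\pi,\mu)$. $H_{4,\dagger}$ is the set of all pairs with $f(\pi)=\frac a2d^2(\pi,\rho)+b\,d_{T,\varepsilon}(\pi,\mu)+c$ and $g(\pi)=G^\dagger(\pi)+b\,B_\varepsilon(\pi,\mu)$. In both cases $g(\pi)=-\infty$ if $\mathcal E(\pi)=+\infty$. For $\gamma,\pi$ with $I(\gamma)+I(\pi)<\infty$, put $$G^\ddagger(\mu)=a[\mathcal E(\mu)-\mathcal E(\gamma)]+\tfrac{a\kappa}2d^2(\mu,\gamma)+\tfrac{a^2}2d^2(\mu,\gamma)-ab\,d(\mu,\gamma)-\tfrac{b^2}2.$$ $H_{3,\ddagger}$ is the set of all pairs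 with $f(\mu)=-\frac a2d^2(\gamma,\mu)+\frac bm\log\Lambda_{\varepsilon,m}(\mu,\pi)+c$ and $g(\mu)=G^\ddagger(\mu)-b\,B_{\varepsilon,m}(\mu,\pi)$. $H_{4,\ddagger}$ is the set of all pairs with $f(\mu)=-\frac a2d^2(\gamma,\mu)-b\,d_{T,\varepsilon}(\mu,\pi)+c$ and $g(\mu)=G^\ddagger(\mu)-b\,B_\varepsilon(\mu,\pi)$. In both cases $g(\mu)=+\infty$ if $\mathcal E(\mu)=+\infty$. **Viscosity solutions.** For $\lambda>0$, a function $u:E\to\mathbb R$ is a viscosity subsolution of $f-\lambda Af=h$ if it is bounded and upper semicontinuous for $d$ and for every $(f,g)\in A$ there is a sequence $(\pi_n)$ in $E$ with $\lim_n(u(\pi_n)-f(\pi_n))=\sup_E(u-f)$ and $\limsup_n\,(u(\pi_n)-\lambda g(\pi_n)-h(\pi_n))\le0$. A function $v:E\to\mathbb R$ is a viscosity supersolution if it is bounded and lower semicontinuous for $d$ and for every $(f,g)\in A$ there is a sequence $(\pi_n)$ with $\lim_n(v(\pi_n)-f(\pi_n))=\inf_E(v-f)$ and $\liminf_n\,(v(\pi_n)-\lambda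 g(\pi_n)-h(\pi_n))\ge0$. **Theorem.** Let $\lambda>0$ and let $h:E\to\mathbb R$ be bounded, continuous, and continuous for the weak topology. Then every weakly upper semicontinuous viscosity subsolution of $f-\lambda H_{3,\dagger}f=h$ is a viscosity subsolution of $f-\lambda H_{4,\dagger}f=h$, and every weakly lower semicontinuous viscosity supersolution of $f-\lambda H_{3,\ddagger}f=h$ is a viscosity supersolution of $f-\lambda H_{4,\ddagger}f=h$. -/

import Mathlib

namespace TataruHJ

open Filter Topology MeasureTheory

noncomputable section

/-! ### Metric space, energy, weak topology, gradient flow -/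

/-- Any two points are joined by a constant speed geodesic defined on `[0, 1]`. -/
def IsGeodesicSpace (E : Type*) [MetricSpace E] : Prop :=
  ∀ x y : E, ∃ γ : ℝ → E, γ 0 = x ∧ γ 1 = y ∧
    ∀ s ∈ Set.Icc (0 : ℝ) 1, ∀ t ∈ Set.Icc (0 : ℝ) 1, dist (γ s) (γ t) = |t - s| * dist x y

/-- Standing assumption on the metric space and on the energy `En : E → (-∞, +∞]`
(completeness is a type class of its own). -/
structure MetricEnergyAssumption {E : Type*} [MetricSpace E] (En : E → EReal) : Prop where
  geodesic : IsGeodesicSpace E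
  ne_bot : ∀ x, En x ≠ ⊥
  proper : ∃ x, En x ≠ ⊤
  lsc : LowerSemicontinuous En

/-- Standing assumption on the weak topology `τ`: it is coarser than the metric topology, the
metric is jointly lower semicontinuous for `τ`, the energy is `τ`-lower semicontinuous on metric
balls, and bounded sublevels of the energy are `τ`-compact. -/
structure WeakTopologyAssumption {E : Type*} [MetricSpace E] (En : E → EReal)
    (τ : TopologicalSpace E) : Prop where
  coarser : (UniformSpace.toTopologicalSpace : TopologicalSpace E) ≤ τ
  lsc_dist : @LowerSemicontinuous (E × E) ℝ (@instTopologicalSpaceProd E E τ τ) _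
    (fun p => dist p.1 p.2)
  lsc_energy : ∀ (x : E) (r : ℝ), @LowerSemicontinuousOn E EReal τ _ En (Metric.closedBall x r)
  compact : ∀ (x : E) (c d : ℝ), @IsCompact E τ {y | dist x y ≤ c ∧ En y ≤ (d : EReal)}

/-- The upper right derivative at `t`, with values in `[-∞, +∞]`. -/
def upperRightDeriv (φ : ℝ → ℝ) (t : ℝ) : EReal :=
  limsup (fun s : ℝ => (((φ (t + s) - φ t) / s : ℝ) : EReal)) (𝓝[>] 0)

/-- `γ`, restricted to `[0, ∞)`, is a solution of the evolution variational inequality with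
parameter `κ`. -/
structure IsEVISolution {E : Type*} [MetricSpace E] (En : E → EReal) (κ : ℝ) (γ : ℝ → E) :
    Prop where
  continuousOn : ContinuousOn γ (Set.Ici 0)
  finite : ∀ t, 0 < t → En (γ t) ≠ ⊤
  evi : ∀ x, En x ≠ ⊤ → ∀ t, 0 ≤ t →
    upperRightDeriv (fun r => dist (γ r) x ^ 2 / 2) t
      ≤ En x - En (γ t) - ((κ / 2 * dist (γ t) x ^ 2 : ℝ) : EReal)

/-- `S x t` (for `t ≥ 0`) is the position at time `t` of the EVI gradient flow of `En`, defined on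
all of `E`, started at `x`. Nothing is asked of `S x t` for `t < 0`. -/
structure IsEVIGradientFlow {E : Type*} [MetricSpace E] (En : E → EReal) (κ : ℝ)
    (S : E → ℝ → E) : Prop where
  continuous : ∀ t, 0 ≤ t → Continuous fun x => S x t
  zero : ∀ x, S x 0 = x
  add : ∀ x s t, 0 ≤ s → 0 ≤ t → S x (t + s) = S (S x t) s
  evi : ∀ x, IsEVISolution En κ (S x)

/-- The local slope `|∂En|`. -/
def localSlope {E : Type*} [MetricSpace E] (En : E → EReal) (x : E) : ENNReal :=
  if En x = ⊤ then ⊤ else limsup (fun y => (En x - En y).toENNReal / edist x y) (𝓝[≠] x)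

/-- The information functional `I = |∂En|²`, equal to `+∞` outside the domain of `En`. -/
def information {E : Type*} [MetricSpace E] (En : E → EReal) (x : E) : ENNReal :=
  if En x = ⊤ then ⊤ else localSlope En x ^ 2

/-! ### Smoothed distance and smoothed Tataru distance -/

/-- `κ̂ = 0 ∧ κ`. -/
def kappaHat (κ : ℝ) : ℝ := min 0 κ

/-- The approximation `ψ_ε` of `r ↦ √(2r)` on `[0, ∞)`. For `r < 0` the polynomial branch is used,
so that the derivative at `0` is the one-sided one. -/
def psi (ε r : ℝ) : ℝ :=
  if r ≤ ε then
    √(2 * ε) + (r - ε) / √(2 * ε) - (r - ε) ^ 2 / (2 * (2 * ε) ^ (3 / 2 : ℝ))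
  else √(2 * r)

/-- `d_ε(x, y) = ψ_ε(d²(x, y) / 2)`. -/
def smoothDist {E : Type*} [MetricSpace E] (ε : ℝ) (x y : E) : ℝ :=
  psi ε (dist x y ^ 2 / 2)

/-- `ψ_ε'(d²(x, y) / 2)`. -/
def smoothDistDeriv {E : Type*} [MetricSpace E] (ε : ℝ) (x y : E) : ℝ :=
  deriv (psi ε) (dist x y ^ 2 / 2)

section Flow

variable {E : Type*} [MetricSpace E]

/-- `h^ε_{x,y}(t) = exp(κ̂ t) d_ε(x, y(t))`, with `y(t)` the flow started at `y`. -/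
def flowCost (κ : ℝ) (S : E → ℝ → E) (ε : ℝ) (x y : E) (t : ℝ) : ℝ :=
  Real.exp (kappaHat κ * t) * smoothDist ε x (S y t)

/-- The smoothed Tataru distance `d_{T,ε}(x, y) = inf_{t ≥ 0} (t + h^ε_{x,y}(t))`. -/
def smoothTataru (κ : ℝ) (S : E → ℝ → E) (ε : ℝ) (x y : E) : ℝ :=
  ⨅ t : Set.Ici (0 : ℝ), ((t : ℝ) + flowCost κ S ε x y t)

/-- The set `Ξ` of minimisers over `t ≥ 0` of `t + h^ε_{x,y}(t)`. -/
def argminSet (κ : ℝ) (S : E → ℝ → E) (ε : ℝ) (x y : E) : Set ℝ :=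
  {t | 0 ≤ t ∧ ∀ s, 0 ≤ s → t + flowCost κ S ε x y t ≤ s + flowCost κ S ε x y s}

/-- `Λ_{ε,m}(x) = ∫ exp(-m h^ε_{x,y}(t)) λ_{m+1}(dt)`, where `λ_{m+1}` is the exponential law of
rate `m + 1`. -/
def laplace (κ : ℝ) (S : E → ℝ → E) (ε : ℝ) (m : ℕ) (x y : E) : ℝ :=
  ∫ t, Real.exp (-(m * flowCost κ S ε x y t)) ∂(ProbabilityTheory.expMeasure ((m : ℝ) + 1))

/-- `∫ exp(-m h(t)) ψ_ε'(d²(x, y(t))/2) exp(κ̂ t) [En(y(t)) - En(x)] λ_{m+1}(dt)`; only used where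
`En x < ∞` and `En y < ∞`. -/
def laplaceEnergy (En : E → EReal) (κ : ℝ) (S : E → ℝ → E) (ε : ℝ) (m : ℕ) (x y : E) : ℝ :=
  ∫ t, Real.exp (-(m * flowCost κ S ε x y t)) * smoothDistDeriv ε x (S y t)
      * Real.exp (kappaHat κ * t) * ((En (S y t)).toReal - (En x).toReal)
    ∂(ProbabilityTheory.expMeasure ((m : ℝ) + 1))

/-- `∫ exp(-m h(t)) (1/m ∨ h(t)) λ_{m+1}(dt)`. -/
def laplaceCost (κ : ℝ) (S : E → ℝ → E) (ε : ℝ) (m : ℕ) (x y : E) : ℝ :=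
  ∫ t, Real.exp (-(m * flowCost κ S ε x y t)) * max (1 / (m : ℝ)) (flowCost κ S ε x y t)
    ∂(ProbabilityTheory.expMeasure ((m : ℝ) + 1))

/-- The supremum over `t ∈ Ξ` of
`exp(κ̂ t) [En(y(t)) - En(x)] ψ_ε'(d²(x, y(t))/2) - (κ̂/2) exp(κ̂ t) d_ε(x, y(t))`;
only used where `En x < ∞` and `En y < ∞`. -/
def flowSup (En : E → EReal) (κ : ℝ) (S : E → ℝ → E) (ε : ℝ) (x y : E) : EReal :=
  ⨆ t ∈ argminSet κ S ε x y,
    ((Real.exp (kappaHat κ * t) * ((En (S y t)).toReal - (En x).toReal)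
        * smoothDistDeriv ε x (S y t)
      - kappaHat κ / 2 * Real.exp (kappaHat κ * t) * smoothDist ε x (S y t) : ℝ) : EReal)

/-! ### The Hamiltonians

Every `g` takes values in `[-∞, +∞]`: the upper Hamiltonians are `-∞`, and the lower ones `+∞`,
exactly where the energy of the argument is `+∞`. -/

/-- Test function of the third upper Hamiltonian. -/
def f3Dag (κ : ℝ) (S : E → ℝ → E) (a b c ε : ℝ) (m : ℕ) (ρ μ π : E) : ℝ :=
  a / 2 * dist π ρ ^ 2 - b / m * Real.log (laplace κ S ε m π μ) + c

/-- Image of `f3Dag`. -/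
def g3Dag (En : E → EReal) (κ : ℝ) (S : E → ℝ → E) (a b ε : ℝ) (m : ℕ) (ρ μ π : E) : EReal :=
  if En π = ⊤ then ⊥ else
    ((a * ((En ρ).toReal - (En π).toReal) - a * (κ / 2) * dist π ρ ^ 2
      + a ^ 2 / 2 * dist π ρ ^ 2 + a * b * dist π ρ + b ^ 2 / 2
      + b * (laplace κ S ε m π μ)⁻¹ * laplaceEnergy En κ S ε m π μ
      - b * (kappaHat κ / 2) * (laplace κ S ε m π μ)⁻¹ * laplaceCost κ S ε m π μ : ℝ) : EReal)

/-- Test function of the third lower Hamiltonian. -/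
def f3Ddag (κ : ℝ) (S : E → ℝ → E) (a b c ε : ℝ) (m : ℕ) (γ π μ : E) : ℝ :=
  -(a / 2) * dist γ μ ^ 2 + b / m * Real.log (laplace κ S ε m μ π) + c

/-- Image of `f3Ddag`. -/
def g3Ddag (En : E → EReal) (κ : ℝ) (S : E → ℝ → E) (a b ε : ℝ) (m : ℕ) (γ π μ : E) : EReal :=
  if En μ = ⊤ then ⊤ else
    ((a * ((En μ).toReal - (En γ).toReal) + a * (κ / 2) * dist μ γ ^ 2
      + a ^ 2 / 2 * dist μ γ ^ 2 - a * b * dist μ γ - b ^ 2 / 2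
      - b * (laplace κ S ε m μ π)⁻¹ * laplaceEnergy En κ S ε m μ π
      + b * (kappaHat κ / 2) * (laplace κ S ε m μ π)⁻¹ * laplaceCost κ S ε m μ π : ℝ) : EReal)

/-- Test function of the fourth upper Hamiltonian. -/
def f4Dag (κ : ℝ) (S : E → ℝ → E) (a b c ε : ℝ) (ρ μ π : E) : ℝ :=
  a / 2 * dist π ρ ^ 2 + b * smoothTataru κ S ε π μ + c

/-- Image of `f4Dag`. -/
def g4Dag (En : E → EReal) (κ : ℝ) (S : E → ℝ → E) (a b ε : ℝ) (ρ μ π : E) : EReal :=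
  if En π = ⊤ then ⊥ else
    ((a * ((En ρ).toReal - (En π).toReal) - a * (κ / 2) * dist π ρ ^ 2
      + a ^ 2 / 2 * dist π ρ ^ 2 + a * b * dist π ρ + b ^ 2 / 2 : ℝ) : EReal)
      + (b : EReal) * flowSup En κ S ε π μ

/-- Test function of the fourth lower Hamiltonian. -/
def f4Ddag (κ : ℝ) (S : E → ℝ → E) (a b c ε : ℝ) (γ π μ : E) : ℝ :=
  -(a / 2) * dist γ μ ^ 2 - b * smoothTataru κ S ε μ π + c

/-- Image of `f4Ddag`. -/
def g4Ddag (En : E → EReal) (κ : ℝ) (S : E → ℝ → E) (a b ε : ℝ) (γ π μ : E) : EReal :=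
  if En μ = ⊤ then ⊤ else
    ((a * ((En μ).toReal - (En γ).toReal) + a * (κ / 2) * dist γ μ ^ 2
      + a ^ 2 / 2 * dist γ μ ^ 2 - a * b * dist γ μ - b ^ 2 / 2 : ℝ) : EReal)
      - (b : EReal) * flowSup En κ S ε μ π

/-- The operator `H_{3,†}`, as a set of pairs. -/
def H3Dag (En : E → EReal) (κ : ℝ) (S : E → ℝ → E) : Set ((E → ℝ) × (E → EReal)) :=
  {p | ∃ (ρ μ : E) (a b ε c : ℝ) (m : ℕ), information En ρ + information En μ < ⊤ ∧
    0 < a ∧ 0 < b ∧ 0 < ε ∧ 1 ≤ m ∧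
    p = (f3Dag κ S a b c ε m ρ μ, g3Dag En κ S a b ε m ρ μ)}

/-- The operator `H_{3,‡}`, as a set of pairs. -/
def H3Ddag (En : E → EReal) (κ : ℝ) (S : E → ℝ → E) : Set ((E → ℝ) × (E → EReal)) :=
  {p | ∃ (γ π : E) (a b ε c : ℝ) (m : ℕ), information En γ + information En π < ⊤ ∧
    0 < a ∧ 0 < b ∧ 0 < ε ∧ 1 ≤ m ∧
    p = (f3Ddag κ S a b c ε m γ π, g3Ddag En κ S a b ε m γ π)}

/-- The operator `H_{4,†}`, as a set of pairs. -/
def H4Dag (En : E → EReal) (κ : ℝ) (S : E → ℝ → E) : Set ((E → ℝ) × (E → EReal)) :=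
  {p | ∃ (ρ μ : E) (a b ε c : ℝ), information En ρ + information En μ < ⊤ ∧
    0 < a ∧ 0 < b ∧ 0 < ε ∧
    p = (f4Dag κ S a b c ε ρ μ, g4Dag En κ S a b ε ρ μ)}

/-- The operator `H_{4,‡}`, as a set of pairs. -/
def H4Ddag (En : E → EReal) (κ : ℝ) (S : E → ℝ → E) : Set ((E → ℝ) × (E → EReal)) :=
  {p | ∃ (γ π : E) (a b ε c : ℝ), information En γ + information En π < ⊤ ∧
    0 < a ∧ 0 < b ∧ 0 < ε ∧
    p = (f4Ddag κ S a b c ε γ π, g4Ddag En κ S a b ε γ π)}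

/-! ### Viscosity sub- and supersolutions (semicontinuity for the metric topology) -/

/-- `u` is a viscosity subsolution of `f - lam * A f = h`. -/
structure IsViscositySubsolution (A : Set ((E → ℝ) × (E → EReal))) (lam : ℝ) (h u : E → ℝ) :
    Prop where
  bounded : ∃ C, ∀ x, |u x| ≤ C
  usc : UpperSemicontinuous u
  sub : ∀ p ∈ A, ∃ x : ℕ → E,
    Tendsto (fun n => ((u (x n) - p.1 (x n) : ℝ) : EReal)) atTop
      (𝓝 (⨆ y, ((u y - p.1 y : ℝ) : EReal))) ∧
    limsup (fun n => (u (x n) : EReal) - (lam : EReal) * p.2 (x n) - (h (x n) : EReal)) atTop ≤ 0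

/-- `v` is a viscosity supersolution of `f - lam * A f = h`. -/
structure IsViscositySupersolution (A : Set ((E → ℝ) × (E → EReal))) (lam : ℝ) (h v : E → ℝ) :
    Prop where
  bounded : ∃ C, ∀ x, |v x| ≤ C
  lsc : LowerSemicontinuous v
  super : ∀ p ∈ A, ∃ x : ℕ → E,
    Tendsto (fun n => ((v (x n) - p.1 (x n) : ℝ) : EReal)) atTop
      (𝓝 (⨅ y, ((v y - p.1 y : ℝ) : EReal))) ∧
    0 ≤ liminf (fun n => (v (x n) : EReal) - (lam : EReal) * p.2 (x n) - (h (x n) : EReal)) atTop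

end Flow

end

end TataruHJ

/-!
The passage from `H3Dag` to `H4Dag` is a Laplace limit. Since `-(1 / m) log Λ_{ε,m}(x, y)`
(`softTataru`) converges to `inf_t (t + h(t)) = d_{T,ε}(x, y)` (`smoothTataru`), the test functions
of the third Hamiltonian converge to those of the fourth. For each `m` the subsolution property
gives a point `x m`, optimal up to `1 / m`, at which the inequality holds up to `1 / m`. These
points have a weak cluster point `z`, and `z` itself, as a constant sequence, witnesses the
property for the fourth Hamiltonian (`exists_optimal_point`).

* Compactness. Comparison with `ρ` bounds `dist (x m) ρ` and `softTataru` at `x m`. The drift term of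
  the Hamiltonian is then bounded above (`eventually_driftAverage_le`), so the term `-a En(x m)` in
  the inequality bounds the energies, and bounded sublevels of the energy are weakly compact.
* Optimality. `u` is weakly upper semicontinuous, the distance is weakly lower semicontinuous, and
  `smoothTataru` at `z` bounds the limit of `softTataru` from below (`eventually_le_add_flowCost`).
  Comparing with the value at `z` shows that `z` is optimal, and that each of these three terms
  converges to its value at `z`.
* The inequality. The weights `exp (-m (t + h(t)))` at `x m` concentrate at times where `t + h(t)` is
  nearly minimal (`laplace_average_le`). Any limit `t` of such times is a minimiser for `z`, and
  `dist (x m) (y(t_m))` converges to `dist z (y(t))`, because otherwise the cost would drop strictly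
  in the limit (`exists_flowDrift_le_of_flowSup_lt`). Hence the averaged drift is asymptotically at
  most `flowSup` at `z`.

About the flow `y(t)`, Grönwall's inequality applied to the evolution variational inequality shows
that the energy is nonincreasing and continuous in `t`. The same inequality at time `0` makes the
energy `κ`-convex along geodesics, hence bounded below by a quadratic function of the distance, so
that along the flow it grows at most exponentially in absolute value. All integrals therefore
converge for large `m`.

The supersolution statement is the same result for `-v`. The two Hamiltonians are mirror images
except for the sign of `a² / 2 * dist²`, which is why `exists_optimal_point` allows an arbitrary
continuous function of the distance to `ρ`.
-/

namespace TataruHJ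

open Filter Topology MeasureTheory

/-! ### The regularised square root -/

/-- The derivative of `psi ε`, in closed form. -/
noncomputable def psiDer (ε r : ℝ) : ℝ :=
  if r ≤ ε then 1 / √(2 * ε) - (r - ε) / (2 * ε) ^ (3 / 2 : ℝ) else 1 / √(2 * r)

theorem hasDerivAt_psi {ε : ℝ} (hε : 0 < ε) (r : ℝ) : HasDerivAt (psi ε) (psiDer ε r) r := by
  have h1 : ∀ x, HasDerivAt (fun r : ℝ => √(2 * ε) + (r - ε) / √(2 * ε)
      - (r - ε) ^ 2 / (2 * (2 * ε) ^ (3 / 2 : ℝ)))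
      (1 / √(2 * ε) - (x - ε) / (2 * ε) ^ (3 / 2 : ℝ)) x := by
    intro x
    have hx : HasDerivAt (fun r : ℝ => r - ε) 1 x := (hasDerivAt_id x).sub_const ε
    refine (((hx.div_const (√(2 * ε))).const_add (√(2 * ε))).sub
      ((hx.pow 2).div_const (2 * (2 * ε) ^ (3 / 2 : ℝ)))).congr_deriv ?_
    norm_num [mul_div_mul_left]
  have h2 : ∀ x, 0 < x → HasDerivAt (fun r : ℝ => √(2 * r)) (1 / √(2 * x)) x := by
    intro x hx
    have := ((hasDerivAt_id' x).const_mul 2).sqrt (by positivity)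
    refine this.congr_deriv ?_
    rw [mul_div_mul_left _ _ two_ne_zero]
  rcases lt_trichotomy r ε with h | h | h
  · rw [psiDer, if_pos h.le]
    refine (h1 r).congr_of_eventuallyEq ?_
    filter_upwards [eventually_lt_nhds h] with x hx
    rw [psi, if_pos hx.le]
  · subst h
    have e1 : HasDerivWithinAt (psi r) (psiDer r r) (Set.Iic r) r := by
      rw [psiDer, if_pos le_rfl]
      refine (h1 r).hasDerivWithinAt.congr (fun x hx => ?_) ?_
      · rw [psi, if_pos (show x ≤ r from hx)]
      · rw [psi, if_pos le_rfl]
    have e2 : HasDerivWithinAt (psi r) (psiDer r r) (Set.Ici r) r := by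
      have : psiDer r r = 1 / √(2 * r) := by simp [psiDer]
      rw [this]
      refine (h2 r hε).hasDerivWithinAt.congr (fun x hx => ?_) ?_
      · rcases eq_or_lt_of_le (show r ≤ x from hx) with rfl | hx
        · simp [psi]
        · rw [psi, if_neg hx.not_ge]
      · simp [psi]
    simpa using e1.union e2
  · rw [psiDer, if_neg h.not_ge]
    refine (h2 r (hε.trans h)).congr_of_eventuallyEq ?_
    filter_upwards [eventually_gt_nhds h] with x hx
    rw [psi, if_neg hx.not_ge]

theorem continuous_psi {ε : ℝ} (hε : 0 < ε) : Continuous (psi ε) :=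
  continuous_iff_continuousAt.2 fun r => (hasDerivAt_psi hε r).continuousAt

theorem psiDer_pos {ε : ℝ} (hε : 0 < ε) (r : ℝ) : 0 < psiDer ε r := by
  unfold psiDer
  split_ifs with h
  · have h1 : 0 < 1 / √(2 * ε) := by positivity
    have h2 : (r - ε) / (2 * ε) ^ (3 / 2 : ℝ) ≤ 0 :=
      div_nonpos_of_nonpos_of_nonneg (by linarith) (by positivity)
    linarith
  · have : 0 < r := by linarith
    positivity

theorem strictMono_psi {ε : ℝ} (hε : 0 < ε) : StrictMono (psi ε) :=
  strictMono_of_hasDerivAt_pos (hasDerivAt_psi hε) (psiDer_pos hε)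

theorem psi_pos {ε r : ℝ} (hε : 0 < ε) (hr : 0 ≤ r) : 0 < psi ε r := by
  refine lt_of_lt_of_le ?_ ((strictMono_psi hε).monotone hr)
  rw [psi, if_pos hε.le]
  have h3 : (2 * ε) ^ (3 / 2 : ℝ) = 2 * ε * √(2 * ε) := by
    rw [Real.sqrt_eq_rpow, show (3 / 2 : ℝ) = 1 + 1 / 2 by norm_num,
      Real.rpow_add (by positivity), Real.rpow_one]
  have hs : 0 < √(2 * ε) := by positivity
  have hq : √(2 * ε) * √(2 * ε) = 2 * ε := Real.mul_self_sqrt (by positivity)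
  rw [h3]
  have : √(2 * ε) + (0 - ε) / √(2 * ε) - (0 - ε) ^ 2 / (2 * (2 * ε * √(2 * ε)))
      = (√(2 * ε) * √(2 * ε) - 5 / 4 * ε) / √(2 * ε) := by
    field_simp
    ring
  rw [this, hq]
  exact div_pos (by linarith) hs

theorem continuous_psiDer {ε : ℝ} (hε : 0 < ε) : Continuous (psiDer ε) := by
  have h : psiDer ε = fun r => if r ≤ ε then 1 / √(2 * ε) - (r - ε) / (2 * ε) ^ (3 / 2 : ℝ)
      else 1 / √(2 * max r ε) := by
    funext r
    unfold psiDer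
    split_ifs with h
    · rfl
    · rw [max_eq_left (by linarith)]
  rw [h]
  refine Continuous.if_le (by fun_prop) ?_ continuous_id continuous_const ?_
  · refine continuous_const.div (by fun_prop) fun r => ?_
    have : 0 < max r ε := lt_max_of_lt_right hε
    positivity
  · rintro r rfl
    simp

theorem exists_psiDer_le {ε : ℝ} (hε : 0 < ε) : ∃ M, 0 < M ∧ ∀ r, 0 ≤ r → psiDer ε r ≤ M := by
  have hp : 0 < (2 * ε) ^ (3 / 2 : ℝ) := by positivity
  have hq : 0 < √(2 * ε) := by positivity
  refine ⟨1 / √(2 * ε) + ε / (2 * ε) ^ (3 / 2 : ℝ), by positivity, fun r hr => ?_⟩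
  unfold psiDer
  split_ifs with h
  · have : (r - ε) / (2 * ε) ^ (3 / 2 : ℝ) ≥ -ε / (2 * ε) ^ (3 / 2 : ℝ) := by
      gcongr
      linarith
    rw [neg_div] at this
    linarith
  · have : 1 / √(2 * r) ≤ 1 / √(2 * ε) := by
      gcongr
      linarith
    have h0 : 0 ≤ ε / (2 * ε) ^ (3 / 2 : ℝ) := by positivity
    linarith

variable {E : Type*} [MetricSpace E]

theorem smoothDistDeriv_eq {ε : ℝ} (hε : 0 < ε) (x y : E) :
    smoothDistDeriv ε x y = psiDer ε (dist x y ^ 2 / 2) :=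
  (hasDerivAt_psi hε _).deriv

theorem smoothDist_pos {ε : ℝ} (hε : 0 < ε) (x y : E) : 0 < smoothDist ε x y :=
  psi_pos hε (by positivity)

theorem flowCost_pos {ε : ℝ} (hε : 0 < ε) (κ : ℝ) (S : E → ℝ → E) (x y : E) (t : ℝ) :
    0 < flowCost κ S ε x y t :=
  mul_pos (Real.exp_pos _) (smoothDist_pos hε _ _)

/-! ### Energy along solutions of the evolution variational inequality -/

section EVI

variable {E : Type*} [MetricSpace E] {En : E → EReal} {κ : ℝ} {γ : ℝ → E}

theorem IsEVISolution.eventually_slope_lt (hγ : IsEVISolution En κ γ) {x : E} (hx : En x ≠ ⊤)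
    {t : ℝ} (ht : 0 ≤ t) {c : ℝ}
    (hc : En x - En (γ t) - ((κ / 2 * dist (γ t) x ^ 2 : ℝ) : EReal) < c) :
    ∀ᶠ z in 𝓝[>] t, (z - t)⁻¹ * (dist (γ z) x ^ 2 / 2 - dist (γ t) x ^ 2 / 2) < c := by
  have h := eventually_lt_of_limsup_lt ((hγ.evi x hx t ht).trans_lt hc)
  have hm : map (fun s => t + s) (𝓝[>] 0) = 𝓝[>] t := by
    simp
  rw [← hm, eventually_map]
  filter_upwards [h] with s hs
  rw [add_sub_cancel_left, inv_mul_eq_div]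
  exact_mod_cast hs

theorem IsEVISolution.eventually_slope_lt_of_real (hEn : ∀ x, En x ≠ ⊥)
    (hγ : IsEVISolution En κ γ) {x : E} (hx : En x ≠ ⊤) {t : ℝ} (ht : 0 ≤ t) (hf : En (γ t) ≠ ⊤)
    {c : ℝ} (hc : (En x).toReal - (En (γ t)).toReal - κ * (dist (γ t) x ^ 2 / 2) < c) :
    ∀ᶠ z in 𝓝[>] t, (z - t)⁻¹ * (dist (γ z) x ^ 2 / 2 - dist (γ t) x ^ 2 / 2) < c := by
  refine hγ.eventually_slope_lt hx ht ?_
  rw [← EReal.coe_toReal hx (hEn x), ← EReal.coe_toReal hf (hEn _)]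
  norm_cast
  linarith

/-- Grönwall's inequality for the squared distance of an EVI solution to a fixed point. -/
theorem IsEVISolution.sq_dist_le_gronwallBound (hEn : ∀ x, En x ≠ ⊥) (hγ : IsEVISolution En κ γ)
    {x : E} (hx : En x ≠ ⊤) {s t K A : ℝ} (hs : 0 ≤ s) (hst : s ≤ t)
    (hf : ∀ r ∈ Set.Ico s t, En (γ r) ≠ ⊤)
    (hb : ∀ r ∈ Set.Ico s t, (En x).toReal - (En (γ r)).toReal - κ * (dist (γ r) x ^ 2 / 2)
      ≤ K * (dist (γ r) x ^ 2 / 2) + A) :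
    dist (γ t) x ^ 2 / 2 ≤ gronwallBound (dist (γ s) x ^ 2 / 2) K A (t - s) := by
  have hc : ContinuousOn γ (Set.Icc s t) :=
    hγ.continuousOn.mono fun r hr => hs.trans hr.1
  refine le_gronwallBound_of_liminf_deriv_right_le (f := fun r => dist (γ r) x ^ 2 / 2)
    (f' := fun r => (En x).toReal - (En (γ r)).toReal - κ * (dist (γ r) x ^ 2 / 2))
    (by fun_prop) ?_ le_rfl hb t ⟨hst, le_rfl⟩
  intro r hr c hc
  exact (hγ.eventually_slope_lt_of_real hEn hx (hs.trans hr.1) (hf r hr) hc).frequently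

theorem IsEVISolution.ne_top (hγ : IsEVISolution En κ γ) (h0 : En (γ 0) ≠ ⊤) {t : ℝ}
    (ht : 0 ≤ t) : En (γ t) ≠ ⊤ := by
  rcases ht.eq_or_lt with rfl | ht
  · exact h0
  · exact hγ.finite t ht

theorem IsEVISolution.antitone_energy (hA : MetricEnergyAssumption En)
    (hγ : IsEVISolution En κ γ) (h0 : En (γ 0) ≠ ⊤) {s t : ℝ} (hs : 0 ≤ s) (hst : s ≤ t) :
    (En (γ t)).toReal ≤ (En (γ s)).toReal := by
  by_contra! hlt
  obtain ⟨C, hC1, hC2⟩ := exists_between hlt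
  -- `r₀` is the last time in `[s, t]` at which the energy is at most `C`
  have hcl : IsClosed (Set.Icc s t ∩ γ ⁻¹' (En ⁻¹' Set.Iic (C : EReal))) :=
    (hγ.continuousOn.mono fun r hr => hs.trans hr.1).preimage_isClosed_of_isClosed isClosed_Icc
      (hA.lsc.isClosed_preimage _)
  have hco := isCompact_Icc.of_isClosed_subset hcl Set.inter_subset_left
  have hle : ∀ r, 0 ≤ r → (En (γ r) ≤ (C : EReal) ↔ (En (γ r)).toReal ≤ C) := by
    intro r hr
    rw [← EReal.coe_le_coe_iff, EReal.coe_toReal (hγ.ne_top h0 hr) (hA.ne_bot _)]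
  have hmem := hco.sSup_mem ⟨s, ⟨le_rfl, hst⟩, (hle s hs).2 hC1.le⟩
  set r₀ := sSup (Set.Icc s t ∩ γ ⁻¹' (En ⁻¹' Set.Iic (C : EReal))) with hr₀
  have hr0 : 0 ≤ r₀ := hs.trans hmem.1.1
  have hr0C : (En (γ r₀)).toReal ≤ C := (hle r₀ hr0).1 hmem.2
  have hgt : ∀ r ∈ Set.Ico r₀ t, (En (γ r₀)).toReal ≤ (En (γ r)).toReal := by
    intro r hr
    rcases hr.1.eq_or_lt with h | h
    · rw [h]
    · by_contra! hcon
      have : r ≤ r₀ := le_csSup hco.bddAbove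
        ⟨⟨hmem.1.1.trans hr.1, hr.2.le⟩, (hle r (hr0.trans hr.1)).2 (hcon.le.trans hr0C)⟩
      linarith
  have hg := hγ.sq_dist_le_gronwallBound hA.ne_bot (hγ.ne_top h0 hr0) (K := -κ) (A := 0) hr0
    hmem.1.2 (fun r hr => hγ.ne_top h0 (hr0.trans hr.1))
    (fun r hr => by linarith [hgt r hr])
  rw [dist_self, zero_pow two_ne_zero, zero_div, gronwallBound_ε0_δ0] at hg
  have hd : dist (γ t) (γ r₀) = 0 := by nlinarith [dist_nonneg (x := γ t) (y := γ r₀)]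
  rw [dist_eq_zero] at hd
  rw [hd] at hC2
  linarith

/-- The energy is continuous along an EVI solution. A downward jump `δ` at `t` would force
`dist (γ s) (γ t) ^ 2 ≥ δ (t - s)` just before `t`, whereas the energy dissipated between `s` and
`t`, jump excluded, tends to zero and controls the ratio of these two quantities. -/
theorem IsEVISolution.continuousOn_energy (hA : MetricEnergyAssumption En)
    (hγ : IsEVISolution En κ γ) (h0 : En (γ 0) ≠ ⊤) :
    ContinuousOn (fun t => (En (γ t)).toReal) (Set.Ici 0) := by
  intro t ht
  have ht : 0 ≤ t := ht
  refine tendsto_order.2 ⟨fun c hc => ?_, fun c hc => ?_⟩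
  · have h1 : (c : EReal) < En (γ t) := by
      rw [← EReal.coe_toReal (hγ.ne_top h0 ht) (hA.ne_bot _)]
      exact_mod_cast hc
    filter_upwards [(hγ.continuousOn t ht).eventually (hA.lsc (γ t) c h1), self_mem_nhdsWithin]
      with z hz hz0
    rw [← EReal.coe_toReal (hγ.ne_top h0 hz0) (hA.ne_bot _)] at hz
    exact_mod_cast hz
  · suffices h : t = 0 ∨ ∃ z, 0 ≤ z ∧ z < t ∧ (En (γ z)).toReal < c by
      rcases h with rfl | ⟨z, hz0, hzt, hz⟩
      · filter_upwards [self_mem_nhdsWithin] with w hw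
        exact (hγ.antitone_energy hA h0 le_rfl hw).trans_lt hc
      · filter_upwards [mem_nhdsWithin_of_mem_nhds (lt_mem_nhds hzt)] with w hw
        exact (hγ.antitone_energy hA h0 hz0 (le_of_lt hw)).trans_lt hz
    rcases ht.eq_or_lt with h | htpos
    · exact Or.inl h.symm
    right
    by_contra! hcon
    set e : ℝ → ℝ := fun r => (En (γ r)).toReal with he
    set K : ℝ := |κ| + 1 with hK
    have hKpos : 0 < K := by positivity
    set δ : ℝ := c - e t with hδ
    have hδpos : 0 < δ := sub_pos.2 hc
    set η : ℝ := δ / 2 * Real.exp (-(K * t)) with hη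
    have hηpos : 0 < η := by positivity
    -- beyond `s`, the energy decreases by less than `η` before `t`
    obtain ⟨s, hs0, hst, hs⟩ : ∃ s, 0 ≤ s ∧ s < t ∧ ∀ r ∈ Set.Ico s t, e s - e r ≤ η := by
      have hne : (e '' Set.Ico 0 t).Nonempty := ⟨_, 0, ⟨le_rfl, htpos⟩, rfl⟩
      have hbdd : BddBelow (e '' Set.Ico 0 t) :=
        ⟨c, by rintro _ ⟨r, hr, rfl⟩; exact hcon r hr.1 hr.2⟩
      obtain ⟨_, ⟨s, hs, rfl⟩, hlt⟩ := exists_lt_of_csInf_lt hne (lt_add_of_pos_right _ hηpos)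
      refine ⟨s, hs.1, hs.2, fun r hr => ?_⟩
      have := csInf_le hbdd ⟨r, ⟨hs.1.trans hr.1, hr.2⟩, rfl⟩
      linarith
    have hfin : ∀ r ∈ Set.Ico s t, En (γ r) ≠ ⊤ := fun r hr => hγ.ne_top h0 (hs0.trans hr.1)
    have hκ : ∀ q : ℝ, 0 ≤ q → -(κ * q) ≤ K * q := fun q hq => by
      nlinarith [neg_abs_le κ, abs_nonneg κ]
    have h1 := hγ.sq_dist_le_gronwallBound hA.ne_bot (hγ.ne_top h0 hs0) (K := K) (A := η) hs0
      hst.le hfin (fun r hr => by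
        have := hκ (dist (γ r) (γ s) ^ 2 / 2) (by positivity)
        linarith [hs r hr])
    have h2 := hγ.sq_dist_le_gronwallBound hA.ne_bot (hγ.ne_top h0 ht) (K := K) (A := -δ) hs0
      hst.le hfin (fun r hr => by
        have := hκ (dist (γ r) (γ t) ^ 2 / 2) (by positivity)
        have := hcon r (hs0.trans hr.1) hr.2
        simp only [he, hδ] at *
        linarith)
    rw [gronwallBound_of_K_ne_0 hKpos.ne'] at h1 h2
    simp only [dist_self, zero_pow two_ne_zero, zero_div, zero_mul, zero_add] at h1 h2
    rw [dist_comm] at h1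
    set X := Real.exp (K * (t - s)) with hX
    have hX1 : 1 < X := Real.one_lt_exp_iff.2 (mul_pos hKpos (sub_pos.2 hst))
    have hXt : X ≤ Real.exp (K * t) := Real.exp_le_exp.2 (by nlinarith)
    have h3 : 0 ≤ (η * X - δ) * ((X - 1) / K) := by
      have := mul_le_mul_of_nonneg_right h1 (by positivity : 0 ≤ X)
      have e1 : (η * X - δ) * ((X - 1) / K) = η / K * (X - 1) * X + -δ / K * (X - 1) := by ring
      rw [e1]
      linarith
    have h4 : 0 ≤ η * X - δ :=
      nonneg_of_mul_nonneg_left h3 (div_pos (by linarith) hKpos)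
    have h5 : η * X ≤ δ / 2 := by
      calc η * X ≤ η * Real.exp (K * t) := by gcongr
        _ = δ / 2 := by rw [hη, mul_assoc, ← Real.exp_add]; simp
    linarith

end EVI

section Flow

variable {E : Type*} [MetricSpace E] {En : E → EReal} {κ : ℝ} {S : E → ℝ → E}

theorem IsEVIGradientFlow.energy_ne_top (hS : IsEVIGradientFlow En κ S) {y : E} (hy : En y ≠ ⊤)
    {t : ℝ} (ht : 0 ≤ t) : En (S y t) ≠ ⊤ :=
  (hS.evi y).ne_top (by rwa [hS.zero]) ht

theorem IsEVIGradientFlow.energy_le (hA : MetricEnergyAssumption En)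
    (hS : IsEVIGradientFlow En κ S) {y : E} (hy : En y ≠ ⊤) {t : ℝ} (ht : 0 ≤ t) :
    (En (S y t)).toReal ≤ (En y).toReal := by
  simpa [hS.zero] using (hS.evi y).antitone_energy hA (by rwa [hS.zero]) le_rfl ht

theorem IsEVIGradientFlow.continuousOn_energy (hA : MetricEnergyAssumption En)
    (hS : IsEVIGradientFlow En κ S) {y : E} (hy : En y ≠ ⊤) :
    ContinuousOn (fun t => (En (S y t)).toReal) (Set.Ici 0) :=
  (hS.evi y).continuousOn_energy hA (by rwa [hS.zero])

/-- The evolution variational inequality at time `0`, for the flow started at an intermediate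
point of a geodesic, gives the `κ`-convexity of the energy along that geodesic. -/
theorem IsEVIGradientFlow.convex_along_geodesic (hA : MetricEnergyAssumption En)
    (hS : IsEVIGradientFlow En κ S) {x y z : E} (hx : En x ≠ ⊤) (hy : En y ≠ ⊤) {s : ℝ}
    (hs0 : 0 < s) (hs1 : s < 1) (hzx : dist z x = s * dist x y)
    (hzy : dist z y = (1 - s) * dist x y) :
    En z ≠ ⊤ ∧ (En z).toReal ≤ (1 - s) * (En x).toReal + s * (En y).toReal
      - κ / 2 * (s * (1 - s)) * dist x y ^ 2 := by
  have key : ∀ cx cy : ℝ,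
      En x - En (S z 0) - ((κ / 2 * dist (S z 0) x ^ 2 : ℝ) : EReal) < cx →
      En y - En (S z 0) - ((κ / 2 * dist (S z 0) y ^ 2 : ℝ) : EReal) < cy →
      0 ≤ (1 - s) * cx + s * cy := by
    intro cx cy hcx hcy
    obtain ⟨r, ⟨hr1, hr2⟩, hr0⟩ := (((hS.evi z).eventually_slope_lt hx le_rfl hcx).and
      ((hS.evi z).eventually_slope_lt hy le_rfl hcy)).and self_mem_nhdsWithin |>.exists
    have hr0 : 0 < r := hr0
    rw [hS.zero, sub_zero, inv_mul_eq_div, div_lt_iff₀ hr0] at hr1 hr2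
    rw [hzx] at hr1
    rw [hzy] at hr2
    set A := dist (S z r) x
    set B := dist (S z r) y
    set D := dist x y
    have hD : D ≤ A + B := dist_triangle_left x y (S z r)
    have hD2 : D ^ 2 ≤ (A + B) ^ 2 := pow_le_pow_left₀ dist_nonneg hD 2
    have h3 : s * (1 - s) * D ^ 2 ≤ s * (1 - s) * (A + B) ^ 2 :=
      mul_le_mul_of_nonneg_left hD2 (mul_nonneg hs0.le (by linarith))
    have h4 := mul_lt_mul_of_pos_left hr1 (by linarith : 0 < 1 - s)
    have h5 := mul_lt_mul_of_pos_left hr2 hs0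
    have h6 : 0 ≤ ((1 - s) * cx + s * cy) * r := by
      nlinarith [sq_nonneg ((1 - s) * A - s * B)]
    exact nonneg_of_mul_nonneg_left h6 hr0
  rw [hS.zero] at key
  have hz : En z ≠ ⊤ := by
    intro hz
    have := key (-1) (-1) (by rw [hz, EReal.sub_top, EReal.bot_sub]; exact EReal.bot_lt_coe _)
      (by rw [hz, EReal.sub_top, EReal.bot_sub]; exact EReal.bot_lt_coe _)
    linarith
  refine ⟨hz, ?_⟩
  rw [← EReal.coe_toReal hx (hA.ne_bot _), ← EReal.coe_toReal hy (hA.ne_bot _),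
    ← EReal.coe_toReal hz (hA.ne_bot _)] at key
  norm_cast at key
  refine le_of_forall_pos_le_add fun η hη => ?_
  have := key _ _ (lt_add_of_pos_right _ hη) (lt_add_of_pos_right _ hη)
  rw [hzx, hzy] at this
  nlinarith

theorem WeakTopologyAssumption.exists_le_energy {τ : TopologicalSpace E}
    (hA : MetricEnergyAssumption En) (hτ : WeakTopologyAssumption En τ) (x : E) (R : ℝ) :
    ∃ L : ℝ, ∀ y, dist y x ≤ R → (L : EReal) ≤ En y := by
  by_cases hne : {y | dist x y ≤ R ∧ En y ≤ ((0 : ℝ) : EReal)}.Nonempty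
  · have hl : @LowerSemicontinuousOn E EReal τ _ En {y | dist x y ≤ R ∧ En y ≤ ((0 : ℝ) : EReal)} :=
      (hτ.lsc_energy x R).mono fun y hy => by
        rw [Metric.mem_closedBall, dist_comm]
        exact hy.1
    obtain ⟨z, hz, hmin⟩ := @LowerSemicontinuousOn.exists_isMinOn E EReal τ _ _ _ hne
      (hτ.compact x R 0) hl
    have hzt : En z ≠ ⊤ := (hz.2.trans_lt (EReal.coe_lt_top 0)).ne
    refine ⟨(En z).toReal, fun y hy => ?_⟩
    rw [EReal.coe_toReal hzt (hA.ne_bot z)]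
    by_cases hy0 : En y ≤ ((0 : ℝ) : EReal)
    · exact hmin ⟨by rwa [dist_comm], hy0⟩
    · exact hz.2.trans (not_le.1 hy0).le
  · refine ⟨0, fun y hy => ?_⟩
    by_contra! hcon
    exact hne ⟨y, by rwa [dist_comm], hcon.le⟩

/-- Convexity and the bound on the unit ball give a quadratic lower bound on the energy. -/
theorem exists_quadratic_le_energy {τ : TopologicalSpace E} (hA : MetricEnergyAssumption En)
    (hS : IsEVIGradientFlow En κ S) (hτ : WeakTopologyAssumption En τ) {x : E} (hx : En x ≠ ⊤) :
    ∃ C : ℝ, 0 ≤ C ∧ ∀ y, En y ≠ ⊤ → -(C * (1 + dist y x ^ 2)) ≤ (En y).toReal := by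
  obtain ⟨L, hL⟩ := hτ.exists_le_energy hA x 1
  have hL' : ∀ y, En y ≠ ⊤ → dist y x ≤ 1 → L ≤ (En y).toReal := by
    intro y hy hd
    have := hL y hd
    rw [← EReal.coe_toReal hy (hA.ne_bot y)] at this
    exact_mod_cast this
  refine ⟨|L| + |(En x).toReal| + |κ|, by positivity, fun y hy => ?_⟩
  have hL0 := neg_abs_le L
  have ha1 := abs_nonneg (En x).toReal
  have ha2 := abs_nonneg κ
  have ha3 := abs_nonneg L
  have hx1 := le_abs_self (En x).toReal
  rcases le_or_gt (dist y x) 1 with h | h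
  · have := hL' y hy h
    nlinarith [sq_nonneg (dist y x)]
  · obtain ⟨g, hg0, hg1, hg⟩ := hA.geodesic x y
    set R := dist y x with hR
    have hRxy : dist x y = R := dist_comm _ _
    have hRpos : 0 < R := by linarith
    set s := 1 / R with hs
    have hs0 : 0 < s := by positivity
    have hs1 : s < 1 := (div_lt_one hRpos).2 h
    have hzx : dist (g s) x = s * dist x y := by
      have := hg s ⟨hs0.le, hs1.le⟩ 0 ⟨le_rfl, zero_le_one⟩
      rwa [hg0, zero_sub, abs_neg, abs_of_pos hs0] at this
    have hzy : dist (g s) y = (1 - s) * dist x y := by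
      have := hg s ⟨hs0.le, hs1.le⟩ 1 ⟨zero_le_one, le_rfl⟩
      rwa [hg1, abs_of_pos (by linarith)] at this
    obtain ⟨hzt, hz⟩ := hS.convex_along_geodesic hA hx hy hs0 hs1 hzx hzy
    have hsR : s * R = 1 := by rw [hs]; field_simp
    have h1 := hL' (g s) hzt (by rw [hzx, hRxy, hsR])
    rw [hRxy] at hz
    have h2 : R * L ≤ (R - 1) * (En x).toReal + (En y).toReal - κ / 2 * (R - 1) * R := by
      have := mul_le_mul_of_nonneg_left (h1.trans hz) hRpos.le
      have e1 : R * ((1 - s) * (En x).toReal + s * (En y).toReal - κ / 2 * (s * (1 - s)) * R ^ 2)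
          = (R - s * R) * (En x).toReal + (s * R) * (En y).toReal
            - κ / 2 * ((s * R) * (R - s * R)) * R := by ring
      rw [e1, hsR] at this
      linarith
    have h3 : (R - 1) * (En x).toReal ≤ (1 + R ^ 2) * |(En x).toReal| := by
      nlinarith [mul_le_mul_of_nonneg_left hx1 (by linarith : 0 ≤ R - 1), sq_nonneg (R - 1)]
    have h4 : -((1 + R ^ 2) * |L|) ≤ R * L := by
      nlinarith [sq_nonneg (R - 1)]
    have h5 : -(κ / 2 * (R - 1) * R) ≤ (1 + R ^ 2) * |κ| := by
      have := mul_le_mul_of_nonneg_left (neg_le_abs κ)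
        (by nlinarith : 0 ≤ (R - 1) * R / 2)
      nlinarith [sq_nonneg (R - 1)]
    linarith

theorem exists_abs_energy_le_exp {τ : TopologicalSpace E} (hA : MetricEnergyAssumption En)
    (hS : IsEVIGradientFlow En κ S) (hτ : WeakTopologyAssumption En τ) {y : E} (hy : En y ≠ ⊤) :
    ∃ C K : ℝ, 0 ≤ C ∧ 0 ≤ K ∧ ∀ t, 0 ≤ t → |(En (S y t)).toReal| ≤ C * Real.exp (K * t) := by
  obtain ⟨C, hC0, hC⟩ := exists_quadratic_le_energy hA hS hτ hy
  set e₀ := (En y).toReal with he₀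
  set A := |e₀| + C with hAdef
  set K := 2 * C + |κ| + 1 with hK
  have hK0 : 0 < K := by positivity
  have hA0 : 0 ≤ A := by positivity
  have hgr : ∀ t, 0 ≤ t → dist (S y t) y ^ 2 / 2 ≤ A / K * Real.exp (K * t) := by
    intro t ht
    have := (hS.evi y).sq_dist_le_gronwallBound hA.ne_bot hy (K := K) (A := A) le_rfl ht
      (fun r hr => hS.energy_ne_top hy hr.1) (fun r hr => by
        have h1 := hC _ (hS.energy_ne_top hy hr.1)
        nlinarith [le_abs_self e₀, neg_abs_le κ, sq_nonneg (dist (S y r) y)])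
    rw [hS.zero, dist_self, zero_pow two_ne_zero, zero_div, gronwallBound_of_K_ne_0 hK0.ne'] at this
    simp only [zero_mul, zero_add, sub_zero] at this
    have h2 : 0 ≤ A / K := by positivity
    linarith
  refine ⟨|e₀| + C + 2 * C * (A / K), K, by positivity, hK0.le, fun t ht => ?_⟩
  have h1 := hS.energy_le hA hy ht
  have h2 := hC _ (hS.energy_ne_top hy ht)
  have h3 := hgr t ht
  have h4 : 1 ≤ Real.exp (K * t) := Real.one_le_exp (by positivity)
  have h5 : 0 ≤ 2 * C * (A / K) * Real.exp (K * t) := by positivity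
  have h6 := mul_le_mul_of_nonneg_left h3 (by positivity : 0 ≤ 2 * C)
  have h7 := mul_le_mul_of_nonneg_left h4 hC0
  have h8 := mul_le_mul_of_nonneg_left h4 (abs_nonneg e₀)
  rw [abs_le]
  constructor
  · nlinarith [abs_nonneg e₀]
  · nlinarith [le_abs_self e₀]

end Flow

/-! ### Laplace asymptotics for exponential laws -/

open ProbabilityTheory in
theorem expMeasure_eq_withDensity_restrict (r : ℝ) :
    expMeasure r = (volume.restrict (Set.Ici 0)).withDensity
      fun t => ENNReal.ofReal (r * Real.exp (-(r * t))) := by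
  rw [← withDensity_indicator measurableSet_Ici]
  change volume.withDensity (exponentialPDF r) = _
  congr 1
  funext t
  rw [exponentialPDF_eq, Set.indicator_apply]
  simp only [Set.mem_Ici]
  split_ifs <;> simp

open ProbabilityTheory in
/-- Tilting the exponential law of rate `1` produces the one of rate `m + 1`. -/
theorem expMeasure_add_one_eq_withDensity (m : ℕ) :
    expMeasure ((m : ℝ) + 1) = (expMeasure 1).withDensity
      fun t => ENNReal.ofReal (((m : ℝ) + 1) * Real.exp (-(m * t))) := by
  rw [expMeasure_eq_withDensity_restrict, expMeasure_eq_withDensity_restrict,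
    ← withDensity_mul _ (by fun_prop) (by fun_prop)]
  congr 1
  funext t
  rw [Pi.mul_apply, ← ENNReal.ofReal_mul (by positivity)]
  congr 1
  rw [show -(((m : ℝ) + 1) * t) = -(1 * t) + -(m * t) by ring, Real.exp_add]
  ring

open ProbabilityTheory

theorem ae_nonneg_expMeasure (r : ℝ) : ∀ᵐ t ∂(expMeasure r), 0 ≤ t := by
  rw [expMeasure_eq_withDensity_restrict]
  exact (withDensity_absolutelyContinuous _ _).ae_le (ae_restrict_mem measurableSet_Ici)

theorem aestronglyMeasurable_expMeasure {f : ℝ → ℝ} (hf : ContinuousOn f (Set.Ici 0)) (r : ℝ) :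
    AEStronglyMeasurable f (expMeasure r) := by
  rw [expMeasure_eq_withDensity_restrict]
  exact (hf.aestronglyMeasurable measurableSet_Ici).mono_ac (withDensity_absolutelyContinuous _ _)

instance : IsProbabilityMeasure (expMeasure 1) := isProbabilityMeasure_expMeasure one_pos

instance (m : ℕ) : IsProbabilityMeasure (expMeasure ((m : ℝ) + 1)) :=
  isProbabilityMeasure_expMeasure (by positivity)

theorem integral_expMeasure_add_one (m : ℕ) (f : ℝ → ℝ) :
    ∫ t, f t ∂(expMeasure ((m : ℝ) + 1))
      = ∫ t, ((m : ℝ) + 1) * Real.exp (-(m * t)) * f t ∂(expMeasure 1) := by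
  rw [expMeasure_add_one_eq_withDensity, integral_withDensity_eq_integral_toReal_smul
    (by fun_prop) (ae_of_all _ fun _ => ENNReal.ofReal_lt_top)]
  refine integral_congr_ae (ae_of_all _ fun t => ?_)
  simp only [smul_eq_mul]
  rw [ENNReal.toReal_ofReal (by positivity)]

theorem integrable_expMeasure_add_one_iff (m : ℕ) (f : ℝ → ℝ) :
    Integrable f (expMeasure ((m : ℝ) + 1))
      ↔ Integrable (fun t => ((m : ℝ) + 1) * Real.exp (-(m * t)) * f t) (expMeasure 1) := by
  rw [expMeasure_add_one_eq_withDensity, integrable_withDensity_iff_integrable_smul'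
    (by fun_prop) (ae_of_all _ fun _ => ENNReal.ofReal_lt_top)]
  refine integrable_congr (ae_of_all _ fun t => ?_)
  simp only [smul_eq_mul]
  rw [ENNReal.toReal_ofReal (by positivity)]

theorem integrable_exp_neg_mul {η : ℝ → ℝ} (hη : ContinuousOn η (Set.Ici 0))
    (hη0 : ∀ t, 0 ≤ t → 0 ≤ η t) (m : ℕ) :
    Integrable (fun t => Real.exp (-(m * η t))) (expMeasure ((m : ℝ) + 1)) := by
  refine Integrable.of_bound (aestronglyMeasurable_expMeasure (by fun_prop) _) 1 ?_
  filter_upwards [ae_nonneg_expMeasure _] with t ht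
  rw [Real.norm_eq_abs, abs_of_pos (Real.exp_pos _), Real.exp_le_one_iff]
  have := hη0 t ht
  have : 0 ≤ m * η t := by positivity
  linarith

theorem integral_exp_neg_mul_pos {η : ℝ → ℝ} (hη : ContinuousOn η (Set.Ici 0))
    (hη0 : ∀ t, 0 ≤ t → 0 ≤ η t) (m : ℕ) :
    0 < ∫ t, Real.exp (-(m * η t)) ∂(expMeasure ((m : ℝ) + 1)) :=
  integral_exp_pos (integrable_exp_neg_mul hη hη0 m)

theorem integral_exp_neg_mul_le {η : ℝ → ℝ} (hη : ContinuousOn η (Set.Ici 0))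
    (hη0 : ∀ t, 0 ≤ t → 0 ≤ η t) (m : ℕ) {q : ℝ} (hq : ∀ t, 0 ≤ t → q ≤ t + η t) :
    ∫ t, Real.exp (-(m * η t)) ∂(expMeasure ((m : ℝ) + 1))
      ≤ ((m : ℝ) + 1) * Real.exp (-(m * q)) := by
  have hi := (integrable_expMeasure_add_one_iff m _).1 (integrable_exp_neg_mul hη hη0 m)
  rw [integral_expMeasure_add_one]
  have : ∫ _, ((m : ℝ) + 1) * Real.exp (-(m * q)) ∂(expMeasure 1)
      = ((m : ℝ) + 1) * Real.exp (-(m * q)) := by simp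
  rw [← this]
  refine integral_mono_ae hi (integrable_const _) ?_
  filter_upwards [ae_nonneg_expMeasure _] with t ht
  rw [mul_assoc, ← Real.exp_add]
  have h1 := hq t ht
  have h2 : (m : ℝ) * q ≤ m * (t + η t) := by gcongr
  gcongr
  linarith

theorem eventually_exp_le_integral_exp_neg_mul {η : ℝ → ℝ} (hη : ContinuousOn η (Set.Ici 0))
    (hη0 : ∀ t, 0 ≤ t → 0 ≤ η t) {t₀ D : ℝ} (ht₀ : 0 ≤ t₀) (hD : t₀ + η t₀ < D) :
    ∀ᶠ m : ℕ in atTop, Real.exp (-(m * D))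
      ≤ ∫ t, Real.exp (-(m * η t)) ∂(expMeasure ((m : ℝ) + 1)) := by
  obtain ⟨D', hD1, hD2⟩ := exists_between hD
  obtain ⟨b, hb, hbJ⟩ : ∃ b, t₀ < b ∧ ∀ t ∈ Set.Ico t₀ b, t + η t < D' := by
    have h1 : Tendsto (fun t => t + η t) (𝓝[≥] t₀) (𝓝 (t₀ + η t₀)) :=
      (continuousOn_id.add hη t₀ ht₀).mono_left (nhdsWithin_mono _ (Set.Ici_subset_Ici.2 ht₀))
    obtain ⟨b, hb, hsub⟩ := mem_nhdsGE_iff_exists_Ico_subset.1 (h1.eventually_lt_const hD1)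
    exact ⟨b, hb, fun t ht => hsub ht⟩
  set J := Set.Ico t₀ b
  have hJpos : 0 < (expMeasure 1).real J := by
    rw [measureReal_def, ENNReal.toReal_pos_iff]
    refine ⟨pos_iff_ne_zero.2 fun h0 => ?_, measure_lt_top _ _⟩
    rw [expMeasure_eq_withDensity_restrict] at h0
    have hac := withDensity_absolutelyContinuous' (μ := volume.restrict (Set.Ici (0 : ℝ)))
      (f := fun t => ENNReal.ofReal (1 * Real.exp (-(1 * t)))) (by fun_prop)
      (ae_of_all _ fun t => by simp [Real.exp_pos])
    have h2 := hac h0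
    rw [Measure.restrict_apply measurableSet_Ico,
      Set.inter_eq_left.2 (Set.Ico_subset_Ici_self.trans (Set.Ici_subset_Ici.2 ht₀)),
      Real.volume_Ico] at h2
    simp only [ENNReal.ofReal_eq_zero] at h2
    linarith
  have hlim : Tendsto (fun m : ℕ => Real.exp (-(m * (D - D')))) atTop (𝓝 0) :=
    Real.tendsto_exp_neg_atTop_nhds_zero.comp
      (tendsto_natCast_atTop_atTop.atTop_mul_const (sub_pos.2 hD2))
  filter_upwards [hlim.eventually_lt_const hJpos] with m hm
  have hi := (integrable_expMeasure_add_one_iff m _).1 (integrable_exp_neg_mul hη hη0 m)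
  rw [integral_expMeasure_add_one]
  calc Real.exp (-(m * D)) = Real.exp (-(m * (D - D'))) * Real.exp (-(m * D')) := by
        rw [← Real.exp_add]; ring_nf
    _ ≤ (expMeasure 1).real J * Real.exp (-(m * D')) := by gcongr
    _ = ∫ t in J, Real.exp (-(m * D')) ∂(expMeasure 1) := by simp
    _ ≤ ∫ t in J, ((m : ℝ) + 1) * Real.exp (-(m * t)) * Real.exp (-(m * η t)) ∂(expMeasure 1) := by
        refine setIntegral_mono_on (integrable_const _) hi.integrableOn measurableSet_Ico
          fun t ht => ?_
        rw [mul_assoc, ← Real.exp_add]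
        have h1 : Real.exp (-(m * D')) ≤ Real.exp (-(m * t) + -(m * η t)) := by
          rw [Real.exp_le_exp]
          have : (m : ℝ) * (t + η t) ≤ m * D' := by
            have := (hbJ t ht).le
            gcongr
          linarith
        have h2 : (0 : ℝ) ≤ m := by positivity
        nlinarith [Real.exp_pos (-(m * t) + -(m * η t))]
    _ ≤ _ := setIntegral_le_integral hi (ae_of_all _ fun t => by positivity)

/-- A quantitative Laplace principle: the average of `X` under the law with density proportional
to `exp (-m η)` is at most the bound `β` of `X` near the minimisers of `t + η t`, up to an error
exponentially small in `m`. -/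
theorem laplace_average_le {η X : ℝ → ℝ} (hη : ContinuousOn η (Set.Ici 0))
    (hη0 : ∀ t, 0 ≤ t → 0 ≤ η t) {m : ℕ} (hm : 1 ≤ m) {p δ β C : ℝ} (hC : 0 ≤ C)
    (hXi : Integrable (fun t => Real.exp (-(m * η t)) * X t) (expMeasure ((m : ℝ) + 1)))
    (hX1 : ∀ t, 0 ≤ t → t + η t ≤ p + δ → X t ≤ β)
    (hX2 : ∀ t, 0 ≤ t → X t ≤ C * (1 + η t))
    (hΛ : Real.exp (-(m * p)) ≤ ∫ t, Real.exp (-(m * η t)) ∂(expMeasure ((m : ℝ) + 1))) :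
    (∫ t, Real.exp (-(m * η t)) ∂(expMeasure ((m : ℝ) + 1)))⁻¹
        * ∫ t, Real.exp (-(m * η t)) * X t ∂(expMeasure ((m : ℝ) + 1))
      ≤ β + (C + |β|) * (m + 1) * Real.exp (p + δ) * Real.exp (-(m * δ)) := by
  have hiΛ := (integrable_expMeasure_add_one_iff m _).1 (integrable_exp_neg_mul hη hη0 m)
  have hiX := (integrable_expMeasure_add_one_iff m _).1 hXi
  set Λ := ∫ t, Real.exp (-(m * η t)) ∂(expMeasure ((m : ℝ) + 1)) with hΛdef
  have hΛpos : 0 < Λ := (Real.exp_pos _).trans_le hΛ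
  have hm1 : (0 : ℝ) ≤ (m : ℝ) - 1 := by
    have : (1 : ℝ) ≤ m := by exact_mod_cast hm
    linarith
  set R := (C + |β|) * (m + 1) * Real.exp (-((m - 1) * (p + δ))) with hR
  have hR0 : 0 ≤ R := by positivity
  have hmain : ∫ t, Real.exp (-(m * η t)) * X t ∂(expMeasure ((m : ℝ) + 1)) ≤ β * Λ + R := by
    rw [hΛdef, integral_expMeasure_add_one, integral_expMeasure_add_one]
    have hconst : ∫ _, R ∂(expMeasure 1) = R := by simp
    rw [← integral_const_mul, ← hconst, ← integral_add (hiΛ.const_mul _) (integrable_const _)]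
    refine integral_mono_ae hiX ((hiΛ.const_mul _).add (integrable_const _)) ?_
    filter_upwards [ae_nonneg_expMeasure _] with t ht
    have hηt := hη0 t ht
    rcases le_or_gt (t + η t) (p + δ) with h | h
    · have h1 : (m + 1) * Real.exp (-(m * t)) * (Real.exp (-(m * η t)) * X t)
          ≤ (m + 1) * Real.exp (-(m * t)) * (Real.exp (-(m * η t)) * β) := by
        gcongr
        exact hX1 t ht h
      linarith
    · have h1 : X t - β ≤ (C + |β|) * (1 + (t + η t)) := by
        have := hX2 t ht
        have h2 := neg_abs_le β
        have h3 := abs_nonneg β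
        nlinarith [mul_nonneg hC ht, mul_nonneg h3 (add_nonneg ht hηt)]
      have h2 : (1 + (t + η t)) ≤ Real.exp (t + η t) := by
        have := Real.add_one_le_exp (t + η t)
        linarith
      have h3 : (m + 1) * Real.exp (-(m * (t + η t))) * (X t - β) ≤ R := by
        calc (m + 1) * Real.exp (-(m * (t + η t))) * (X t - β)
            ≤ (m + 1) * Real.exp (-(m * (t + η t))) * ((C + |β|) * Real.exp (t + η t)) := by
              gcongr
              exact h1.trans (by gcongr)
          _ = (C + |β|) * (m + 1) * (Real.exp (-(m * (t + η t))) * Real.exp (t + η t)) := by ring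
          _ = (C + |β|) * (m + 1) * Real.exp (-((m - 1) * (t + η t))) := by
              rw [← Real.exp_add]; ring_nf
          _ ≤ R := by
              rw [hR]
              gcongr
      have h4 : Real.exp (-(m * (t + η t))) = Real.exp (-(m * t)) * Real.exp (-(m * η t)) := by
        rw [← Real.exp_add]; ring_nf
      rw [h4] at h3
      linarith
  have hinv : Λ⁻¹ ≤ Real.exp (m * p) := by
    rw [inv_le_comm₀ hΛpos (Real.exp_pos _), ← Real.exp_neg]
    exact hΛ
  calc Λ⁻¹ * ∫ t, Real.exp (-(m * η t)) * X t ∂(expMeasure ((m : ℝ) + 1))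
      ≤ Λ⁻¹ * (β * Λ + R) := by gcongr
    _ = β + Λ⁻¹ * R := by field_simp
    _ ≤ β + Real.exp (m * p) * R := by gcongr
    _ = β + (C + |β|) * (m + 1) * Real.exp (p + δ) * Real.exp (-(m * δ)) := by
        have : Real.exp (m * p) * Real.exp (-((m - 1) * (p + δ)))
            = Real.exp (p + δ) * Real.exp (-(m * δ)) := by
          rw [← Real.exp_add, ← Real.exp_add]; ring_nf
        rw [hR]
        linear_combination (C + |β|) * (m + 1) * this

theorem tendsto_add_one_mul_exp_neg {δ : ℝ} (hδ : 0 < δ) :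
    Tendsto (fun m : ℕ => ((m : ℝ) + 1) * Real.exp (-(m * δ))) atTop (𝓝 0) := by
  have h1 : Tendsto (fun x : ℝ => (x + 1) * Real.exp (-(x * δ))) atTop (𝓝 0) := by
    have ha := Real.tendsto_pow_mul_exp_neg_atTop_nhds_zero 1 |>.comp
      (tendsto_id.atTop_mul_const hδ)
    have hb := Real.tendsto_exp_neg_atTop_nhds_zero.comp
      ((tendsto_id (α := ℝ)).atTop_mul_const hδ)
    have := (ha.const_mul δ⁻¹).add hb
    simp only [mul_zero, add_zero] at this
    refine this.congr fun x => ?_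
    simp only [Function.comp, id, pow_one]
    field_simp
  exact h1.comp tendsto_natCast_atTop_atTop

/-! ### The exponentially weighted averages of the flow -/

section FlowAverages

variable {E : Type*} [MetricSpace E] {En : E → EReal} {κ : ℝ} {S : E → ℝ → E} {ε : ℝ}

theorem continuousOn_sq_dist_flow (hS : IsEVIGradientFlow En κ S) (x y : E) :
    ContinuousOn (fun t => dist x (S y t) ^ 2 / 2) (Set.Ici 0) := by
  have h1 := (hS.evi y).continuousOn
  fun_prop

theorem continuousOn_flowCost (hS : IsEVIGradientFlow En κ S) (hε : 0 < ε) (x y : E) :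
    ContinuousOn (flowCost κ S ε x y) (Set.Ici 0) := by
  have h3 : ContinuousOn (fun t => psi ε (dist x (S y t) ^ 2 / 2)) (Set.Ici 0) :=
    (continuous_psi hε).comp_continuousOn (continuousOn_sq_dist_flow hS x y)
  exact (by fun_prop : ContinuousOn (fun t => Real.exp (kappaHat κ * t)) _).mul h3

/-- The integrand averaged in the image of the third Hamiltonians. -/
noncomputable def flowDrift (En : E → EReal) (κ : ℝ) (S : E → ℝ → E) (ε : ℝ) (m : ℕ) (x y : E)
    (t : ℝ) : ℝ :=
  smoothDistDeriv ε x (S y t) * Real.exp (kappaHat κ * t)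
      * ((En (S y t)).toReal - (En x).toReal)
    - kappaHat κ / 2 * max (1 / (m : ℝ)) (flowCost κ S ε x y t)

theorem kappaHat_nonpos (κ : ℝ) : kappaHat κ ≤ 0 := min_le_left _ _

/-- For large `m`, the exponential law of rate `m + 1` compensates the growth of the energy along
the flow, so that no integral in the third Hamiltonians takes its default value. -/
theorem eventually_integrable_flowDrift {τ : TopologicalSpace E} (hA : MetricEnergyAssumption En)
    (hS : IsEVIGradientFlow En κ S) (hτ : WeakTopologyAssumption En τ) (hε : 0 < ε) {y : E}
    (hy : En y ≠ ⊤) :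
    ∀ᶠ m : ℕ in atTop, ∀ x,
      Integrable (fun t => Real.exp (-(m * flowCost κ S ε x y t)) * flowDrift En κ S ε m x y t)
        (expMeasure ((m : ℝ) + 1)) ∧
      laplaceEnergy En κ S ε m x y - kappaHat κ / 2 * laplaceCost κ S ε m x y
        = ∫ t, Real.exp (-(m * flowCost κ S ε x y t)) * flowDrift En κ S ε m x y t
          ∂(expMeasure ((m : ℝ) + 1)) := by
  obtain ⟨C, K, hC, hK, hCK⟩ := exists_abs_energy_le_exp hA hS hτ hy
  obtain ⟨M, hM, hMψ⟩ := exists_psiDer_le hε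
  filter_upwards [eventually_ge_atTop 1, tendsto_natCast_atTop_atTop.eventually_ge_atTop K]
    with m hm hmK x
  have hm1 : (1 : ℝ) ≤ m := by exact_mod_cast hm
  have hη := continuousOn_flowCost hS hε x y
  have hη0 : ∀ t, 0 < flowCost κ S ε x y t := flowCost_pos hε κ S x y
  have hγ := (hS.evi y).continuousOn
  have hi1 : Integrable (fun t => Real.exp (-(m * flowCost κ S ε x y t))
      * smoothDistDeriv ε x (S y t) * Real.exp (kappaHat κ * t)
      * ((En (S y t)).toReal - (En x).toReal)) (expMeasure ((m : ℝ) + 1)) := by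
    rw [integrable_expMeasure_add_one_iff]
    have he := hS.continuousOn_energy hA hy
    have hd : ContinuousOn (fun t => smoothDistDeriv ε x (S y t)) (Set.Ici 0) := by
      simp_rw [smoothDistDeriv_eq hε]
      exact (continuous_psiDer hε).comp_continuousOn (continuousOn_sq_dist_flow hS x y)
    refine Integrable.of_bound (aestronglyMeasurable_expMeasure (by fun_prop) _)
      ((m + 1) * (M * (C + |(En x).toReal|))) ?_
    filter_upwards [ae_nonneg_expMeasure _] with t ht
    have h1 : Real.exp (-(m * flowCost κ S ε x y t)) ≤ 1 := by
      rw [Real.exp_le_one_iff]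
      have := hη0 t
      have : 0 ≤ m * flowCost κ S ε x y t := by positivity
      linarith
    have h2 : Real.exp (kappaHat κ * t) ≤ 1 := by
      rw [Real.exp_le_one_iff]
      nlinarith [kappaHat_nonpos κ]
    have h3 : smoothDistDeriv ε x (S y t) ≤ M := by
      rw [smoothDistDeriv_eq hε]
      exact hMψ _ (by positivity)
    have h3' : 0 < smoothDistDeriv ε x (S y t) := by
      rw [smoothDistDeriv_eq hε]
      exact psiDer_pos hε _
    have h4 : Real.exp (-(m * t)) * |(En (S y t)).toReal - (En x).toReal|
        ≤ C + |(En x).toReal| := by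
      have e1 : |(En (S y t)).toReal - (En x).toReal| ≤ C * Real.exp (K * t) + |(En x).toReal| :=
        (abs_sub _ _).trans (by gcongr; exact hCK t ht)
      have e2 : Real.exp (-(m * t)) * Real.exp (K * t) ≤ 1 := by
        rw [← Real.exp_add, Real.exp_le_one_iff]
        nlinarith
      have e3 : Real.exp (-(m * t)) ≤ 1 := by
        rw [Real.exp_le_one_iff]
        nlinarith
      calc _ ≤ Real.exp (-(m * t)) * (C * Real.exp (K * t) + |(En x).toReal|) := by gcongr
        _ = C * (Real.exp (-(m * t)) * Real.exp (K * t))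
            + Real.exp (-(m * t)) * |(En x).toReal| := by ring
        _ ≤ C * 1 + 1 * |(En x).toReal| := by gcongr
        _ = _ := by ring
    rw [Real.norm_eq_abs, abs_mul, abs_mul _ (_ - _), abs_of_pos (by positivity),
      abs_of_pos (by positivity)]
    calc _ = (m + 1) * ((Real.exp (-(m * flowCost κ S ε x y t)) * smoothDistDeriv ε x (S y t)
          * Real.exp (kappaHat κ * t))
          * (Real.exp (-(m * t)) * |(En (S y t)).toReal - (En x).toReal|)) := by ring
      _ ≤ (m + 1) * ((1 * M * 1) * (C + |(En x).toReal|)) := by gcongr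
      _ = _ := by ring
  have hi2 : Integrable (fun t => Real.exp (-(m * flowCost κ S ε x y t))
      * max (1 / (m : ℝ)) (flowCost κ S ε x y t)) (expMeasure ((m : ℝ) + 1)) := by
    refine Integrable.of_bound (aestronglyMeasurable_expMeasure (by fun_prop) _) 1 ?_
    refine ae_of_all _ fun t => ?_
    have hηt := hη0 t
    rw [Real.norm_eq_abs, abs_of_nonneg (by positivity), Real.exp_neg, inv_mul_le_iff₀
      (Real.exp_pos _), mul_one]
    have h1 := Real.add_one_le_exp (m * flowCost κ S ε x y t)
    refine max_le ?_ ?_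
    · have : 1 / (m : ℝ) ≤ 1 := (div_le_one (by positivity)).2 hm1
      nlinarith
    · nlinarith
  have hsplit : (fun t => Real.exp (-(m * flowCost κ S ε x y t)) * flowDrift En κ S ε m x y t)
      = fun t => Real.exp (-(m * flowCost κ S ε x y t))
          * smoothDistDeriv ε x (S y t) * Real.exp (kappaHat κ * t)
          * ((En (S y t)).toReal - (En x).toReal)
        - kappaHat κ / 2 * (Real.exp (-(m * flowCost κ S ε x y t))
          * max (1 / (m : ℝ)) (flowCost κ S ε x y t)) := by
    funext t
    rw [flowDrift]
    ring
  rw [hsplit]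
  refine ⟨hi1.sub (hi2.const_mul _), ?_⟩
  rw [integral_sub hi1 (hi2.const_mul _), integral_const_mul, laplaceEnergy, laplaceCost]

/-- The integrand grows at most linearly in the cost, uniformly over points whose energy is
bounded below. -/
theorem exists_flowDrift_le (hA : MetricEnergyAssumption En) (hS : IsEVIGradientFlow En κ S)
    (hε : 0 < ε) {y : E} (hy : En y ≠ ⊤) (L : ℝ) :
    ∃ C, 0 ≤ C ∧ ∀ m : ℕ, 1 ≤ m → ∀ x, L ≤ (En x).toReal → ∀ t, 0 ≤ t →
      flowDrift En κ S ε m x y t ≤ C * (1 + flowCost κ S ε x y t) := by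
  obtain ⟨M, hM, hMψ⟩ := exists_psiDer_le hε
  set P := max 0 ((En y).toReal - L) with hP
  refine ⟨M * P + |kappaHat κ|, by positivity, fun m hm x hx t ht => ?_⟩
  have hm1 : (1 : ℝ) ≤ m := by exact_mod_cast hm
  have hη := flowCost_pos hε κ S x y t
  have h2 : Real.exp (kappaHat κ * t) ≤ 1 := by
    rw [Real.exp_le_one_iff]
    nlinarith [kappaHat_nonpos κ]
  have h3 : smoothDistDeriv ε x (S y t) ≤ M := by
    rw [smoothDistDeriv_eq hε]
    exact hMψ _ (by positivity)
  have h3' : 0 < smoothDistDeriv ε x (S y t) := by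
    rw [smoothDistDeriv_eq hε]
    exact psiDer_pos hε _
  have h4 : (En (S y t)).toReal - (En x).toReal ≤ P :=
    (sub_le_sub (hS.energy_le hA hy ht) hx).trans (le_max_right _ _)
  have hP0 : 0 ≤ P := le_max_left _ _
  have h5 : smoothDistDeriv ε x (S y t) * Real.exp (kappaHat κ * t)
      * ((En (S y t)).toReal - (En x).toReal) ≤ M * 1 * P :=
    (mul_le_mul_of_nonneg_left h4 (by positivity)).trans (by gcongr)
  have h6 : max (1 / (m : ℝ)) (flowCost κ S ε x y t) ≤ 1 + flowCost κ S ε x y t := by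
    refine max_le ?_ (by linarith)
    have : 1 / (m : ℝ) ≤ 1 := (div_le_one (by positivity)).2 hm1
    linarith
  have h6' : 0 ≤ max (1 / (m : ℝ)) (flowCost κ S ε x y t) := by positivity
  have h7 : -(kappaHat κ / 2 * max (1 / (m : ℝ)) (flowCost κ S ε x y t))
      ≤ |kappaHat κ| * (1 + flowCost κ S ε x y t) := by
    calc -(kappaHat κ / 2 * max (1 / (m : ℝ)) (flowCost κ S ε x y t))
        = -kappaHat κ / 2 * max (1 / (m : ℝ)) (flowCost κ S ε x y t) := by ring
      _ ≤ |kappaHat κ| * max (1 / (m : ℝ)) (flowCost κ S ε x y t) := by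
        gcongr
        linarith [neg_le_abs (kappaHat κ), abs_nonneg (kappaHat κ)]
      _ ≤ _ := by gcongr
  have h8 : 0 ≤ M * P * flowCost κ S ε x y t := by positivity
  rw [flowDrift]
  linarith

end FlowAverages

/-! ### Passage to the limit along weakly convergent points -/

theorem exists_tendsto_of_mem_Icc {α : Type*} (W : Ultrafilter α) {f : α → ℝ} {l r : ℝ}
    (h : ∀ᶠ i in (W : Filter α), f i ∈ Set.Icc l r) :
    ∃ v ∈ Set.Icc l r, Tendsto f W (𝓝 v) := by
  obtain ⟨v, hv, hle⟩ := isCompact_Icc.ultrafilter_le_nhds (W.map f)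
    (le_principal_iff.2 h)
  exact ⟨v, hv, hle⟩

section Weak

variable {E : Type*} [MetricSpace E] {En : E → EReal} {κ : ℝ} {S : E → ℝ → E} {ε : ℝ}

theorem IsEVIGradientFlow.tendsto_flow (hS : IsEVIGradientFlow En κ S) {α : Type*} {l : Filter α}
    {s : α → ℝ} {t : ℝ} (ht : 0 ≤ t) (hs : Tendsto s l (𝓝[Set.Ici 0] t)) (y : E) :
    Tendsto (fun i => S y (s i)) l (𝓝 (S y t)) :=
  ((hS.evi y).continuousOn t ht).tendsto.comp hs

theorem IsEVIGradientFlow.eventually_dist_flow_le (hS : IsEVIGradientFlow En κ S) {α : Type*}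
    {l : Filter α} {s : α → ℝ} {t : ℝ} (ht : 0 ≤ t) (hs : Tendsto s l (𝓝[Set.Ici 0] t)) (w y : E) :
    ∀ᶠ i in l, dist w (S y (s i)) ≤ dist w (S y t) + 1 :=
  (tendsto_const_nhds.dist (hS.tendsto_flow ht hs y)).eventually_le_const (lt_add_one _)

variable {τ : TopologicalSpace E}

theorem WeakTopologyAssumption.tendsto (hτ : WeakTopologyAssumption En τ) {α : Type*}
    {l : Filter α} {p : α → E} {x : E}
    (hp : Tendsto p l (@nhds E UniformSpace.toTopologicalSpace x)) : Tendsto p l (@nhds E τ x) :=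
  hp.mono_right (@_root_.nhds_mono E UniformSpace.toTopologicalSpace τ x hτ.coarser)

theorem WeakTopologyAssumption.dist_le_of_tendsto (hτ : WeakTopologyAssumption En τ) {α : Type*}
    {l : Filter α} [l.NeBot] {p q : α → E} {x y : E} {d : ℝ} (hp : Tendsto p l (@nhds E τ x))
    (hq : Tendsto q l (@nhds E τ y)) (hd : Tendsto (fun i => dist (p i) (q i)) l (𝓝 d)) :
    dist x y ≤ d := by
  by_contra! hlt
  obtain ⟨c, hc1, hc2⟩ := exists_between hlt
  have h1 := hτ.lsc_dist (x, y) c hc2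
  rw [@nhds_prod_eq E E τ τ] at h1
  obtain ⟨i, hi1, hi2⟩ :=
    (((hp.prodMk hq).eventually h1).and (hd.eventually_lt_const hc1)).exists
  exact absurd hi1 hi2.not_gt

theorem WeakTopologyAssumption.energy_le_of_tendsto (hA : MetricEnergyAssumption En)
    (hτ : WeakTopologyAssumption En τ) {α : Type*} {l : Filter α} [l.NeBot] {p : α → E} {x w : E}
    {R e : ℝ} (hp : Tendsto p l (@nhds E τ x)) (hb : ∀ᶠ i in l, dist (p i) w ≤ R)
    (hx : dist x w ≤ R) (hxt : En x ≠ ⊤) (hpt : ∀ᶠ i in l, En (p i) ≠ ⊤)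
    (he : Tendsto (fun i => (En (p i)).toReal) l (𝓝 e)) : (En x).toReal ≤ e := by
  by_contra! hlt
  obtain ⟨c, hc1, hc2⟩ := exists_between hlt
  have hc2' : (c : EReal) < En x := by
    rw [← EReal.coe_toReal hxt (hA.ne_bot x)]
    exact_mod_cast hc2
  have h1 := hτ.lsc_energy w R x hx c hc2'
  have h2 : Tendsto p l (@nhdsWithin E τ x (Metric.closedBall w R)) :=
    tendsto_inf.2 ⟨hp, tendsto_principal.2 hb⟩
  obtain ⟨i, ⟨hi1, hi2⟩, hi3⟩ :=
    (((h2.eventually h1).and (he.eventually_lt_const hc1)).and hpt).exists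
  rw [← EReal.coe_toReal hi3 (hA.ne_bot _)] at hi1
  have : c < (En (p i)).toReal := by exact_mod_cast hi1
  linarith

/-- Times at which the total cost stays bounded converge along an ultrafilter, and in the limit the
distance to the flow can only drop. -/
theorem exists_limit_time (hS : IsEVIGradientFlow En κ S) (hτ : WeakTopologyAssumption En τ)
    (hε : 0 < ε) {α : Type*} (W : Ultrafilter α) {p : α → E} {s : α → ℝ} {z w y : E} {R M : ℝ}
    (hp : Tendsto p W (@nhds E τ z)) (hb : ∀ᶠ i in (W : Filter α), dist (p i) w ≤ R)
    (hs0 : ∀ᶠ i in (W : Filter α), 0 ≤ s i)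
    (hsM : ∀ᶠ i in (W : Filter α), s i + flowCost κ S ε (p i) y (s i) ≤ M) :
    ∃ t, 0 ≤ t ∧ ∃ d, dist z (S y t) ≤ d ∧ Tendsto s W (𝓝[Set.Ici 0] t) ∧
      Tendsto (fun i => dist (p i) (S y (s i))) W (𝓝 d) ∧
      Tendsto (fun i => flowCost κ S ε (p i) y (s i)) W
        (𝓝 (Real.exp (kappaHat κ * t) * psi ε (d ^ 2 / 2))) := by
  obtain ⟨t, ht, hst⟩ := exists_tendsto_of_mem_Icc W (f := s) (l := 0) (r := M) (by
    filter_upwards [hs0, hsM] with i h1 h2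
    exact ⟨h1, by linarith [flowCost_pos hε κ S (p i) y (s i)]⟩)
  have hst' : Tendsto s W (𝓝[Set.Ici 0] t) := tendsto_nhdsWithin_iff.2 ⟨hst, hs0⟩
  have hflow := hS.tendsto_flow ht.1 hst' y
  have hbd : ∀ᶠ i in (W : Filter α),
      dist (p i) (S y (s i)) ∈ Set.Icc 0 (R + (dist w (S y t) + 1)) := by
    filter_upwards [hb, hS.eventually_dist_flow_le ht.1 hst' w y] with i h2 h3
    refine ⟨dist_nonneg, (dist_triangle _ w _).trans ?_⟩
    linarith
  obtain ⟨d, -, hd⟩ := exists_tendsto_of_mem_Icc W hbd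
  refine ⟨t, ht.1, d, hτ.dist_le_of_tendsto hp (hτ.tendsto hflow) hd, hst', hd, ?_⟩
  have h1 : Tendsto (fun i => Real.exp (kappaHat κ * s i)) W (𝓝 (Real.exp (kappaHat κ * t))) :=
    (Real.continuous_exp.tendsto _).comp (hst.const_mul _)
  exact h1.mul (((continuous_psi hε).tendsto _).comp ((hd.pow 2).div_const 2))

/-- Weak lower semicontinuity of the minimal cost, uniformly in time. -/
theorem eventually_le_add_flowCost (hS : IsEVIGradientFlow En κ S)
    (hτ : WeakTopologyAssumption En τ) (hε : 0 < ε) {α : Type*} (W : Ultrafilter α) {p : α → E}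
    {z w y : E} {R D D' : ℝ} (hp : Tendsto p W (@nhds E τ z))
    (hb : ∀ᶠ i in (W : Filter α), dist (p i) w ≤ R)
    (hD : ∀ t, 0 ≤ t → D ≤ t + flowCost κ S ε z y t) (hD' : D' < D) :
    ∀ᶠ i in (W : Filter α), ∀ t, 0 ≤ t → D' ≤ t + flowCost κ S ε (p i) y t := by
  by_contra hcon
  rw [← Ultrafilter.eventually_not] at hcon
  push Not at hcon
  obtain ⟨s, hs⟩ := hcon.choice
  obtain ⟨t, ht, d, hd, hst, -, hc⟩ := exists_limit_time hS hτ hε W hp hb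
    (hs.mono fun i h => h.1) (hs.mono fun i h => h.2.le)
  have h1 := le_of_tendsto ((hst.mono_right nhdsWithin_le_nhds).add hc)
    (hs.mono fun i h => h.2.le)
  have h2 : flowCost κ S ε z y t ≤ Real.exp (kappaHat κ * t) * psi ε (d ^ 2 / 2) := by
    refine mul_le_mul_of_nonneg_left ((strictMono_psi hε).monotone ?_) (Real.exp_pos _).le
    gcongr
  have := hD t ht
  linarith

/-- Near-minimal times of the approximating costs accumulate only at minimisers of the limiting
cost, where the integrand `flowDrift` is controlled by `flowSup`. -/
theorem exists_flowDrift_le_of_flowSup_lt (hA : MetricEnergyAssumption En)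
    (hS : IsEVIGradientFlow En κ S) (hτ : WeakTopologyAssumption En τ) (hε : 0 < ε)
    (U : Ultrafilter ℕ) (hU : (U : Filter ℕ) ≤ atTop) {x : ℕ → E} {z w y : E} {R D β e : ℝ}
    (hy : En y ≠ ⊤) (hx : Tendsto x U (@nhds E τ z))
    (hb : ∀ᶠ n in (U : Filter ℕ), dist (x n) w ≤ R)
    (hD : ∀ t, 0 ≤ t → D ≤ t + flowCost κ S ε z y t)
    (he : Tendsto (fun n => (En (x n)).toReal) U (𝓝 e)) (hez : (En z).toReal ≤ e)
    (hβ : flowSup En κ S ε z y < β) :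
    ∃ δ > 0, ∀ᶠ n in (U : Filter ℕ), ∀ t, 0 ≤ t →
      t + flowCost κ S ε (x n) y t ≤ D + δ → flowDrift En κ S ε n (x n) y t ≤ β := by
  by_contra! hcon
  -- almost minimise the cost among the times at which the bound fails
  have hex : ∀ᶠ n in (U : Filter ℕ), ∃ s, 0 ≤ s ∧ β < flowDrift En κ S ε n (x n) y s ∧
      ∀ t, 0 ≤ t → β < flowDrift En κ S ε n (x n) y t →
        s + flowCost κ S ε (x n) y s ≤ t + flowCost κ S ε (x n) y t + 1 / (n + 1) := by
    filter_upwards [hcon 1 one_pos] with n hn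
    obtain ⟨t₀, ht₀, -, hβ₀⟩ := hn
    set B := {t : ℝ | 0 ≤ t ∧ β < flowDrift En κ S ε n (x n) y t}
    have hne : B.Nonempty := ⟨t₀, ht₀, hβ₀⟩
    have hbdd : BddBelow ((fun t => t + flowCost κ S ε (x n) y t) '' B) := by
      refine ⟨0, ?_⟩
      rintro _ ⟨t, ht, rfl⟩
      exact add_nonneg ht.1 (flowCost_pos hε κ S _ _ _).le
    obtain ⟨_, ⟨s, hs, rfl⟩, hlt⟩ := exists_lt_of_csInf_lt
      (hne.image fun t => t + flowCost κ S ε (x n) y t)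
      (lt_add_of_pos_right (sInf ((fun t => t + flowCost κ S ε (x n) y t) '' B))
        (Nat.one_div_pos_of_nat (α := ℝ) (n := n)))
    refine ⟨s, hs.1, hs.2, fun t ht htβ => ?_⟩
    have := csInf_le hbdd ⟨t, ⟨ht, htβ⟩, rfl⟩
    simp only at hlt this
    linarith
  obtain ⟨s, hs⟩ := hex.choice
  have hn : Tendsto (fun n : ℕ => 1 / ((n : ℝ) + 1)) U (𝓝 0) :=
    tendsto_one_div_add_atTop_nhds_zero_nat.mono_left hU
  have hsD : ∀ δ > 0, ∀ᶠ n in (U : Filter ℕ),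
      s n + flowCost κ S ε (x n) y (s n) ≤ D + δ + 1 / ((n : ℝ) + 1) := by
    intro δ hδ
    filter_upwards [hs, hcon δ hδ] with n h1 h2
    obtain ⟨t, ht0, ht1, ht2⟩ := h2
    linarith [h1.2.2 t ht0 ht2]
  have hs0 : ∀ᶠ n in (U : Filter ℕ), 0 ≤ s n := hs.mono fun n h => h.1
  obtain ⟨t, ht, d, hd, hst, hdd, hc⟩ := exists_limit_time hS hτ hε U (M := D + 1 + 1) hx hb hs0 (by
    filter_upwards [hsD 1 one_pos, hn.eventually_lt_const one_pos] with n h1 h2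
    linarith)
  have hst' := hst.mono_right nhdsWithin_le_nhds
  have hlim : t + Real.exp (kappaHat κ * t) * psi ε (d ^ 2 / 2) ≤ D := by
    refine le_of_forall_pos_le_add fun δ hδ => ?_
    have := le_of_tendsto_of_tendsto (hst'.add hc) (hn.const_add (D + δ)) (hsD δ hδ)
    simpa using this
  have hDt := hD t ht
  have hzd : d = dist z (S y t) := by
    refine le_antisymm ?_ hd
    have h1 : Real.exp (kappaHat κ * t) * psi ε (d ^ 2 / 2)
        ≤ Real.exp (kappaHat κ * t) * psi ε (dist z (S y t) ^ 2 / 2) := by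
      have := hD t ht
      rw [flowCost, smoothDist] at this
      linarith
    have h2 := (strictMono_psi hε).le_iff_le.1 (le_of_mul_le_mul_left h1 (Real.exp_pos _))
    exact le_of_sq_le_sq (by linarith) dist_nonneg
  subst hzd
  have hcost : Real.exp (kappaHat κ * t) * psi ε (dist z (S y t) ^ 2 / 2)
      = flowCost κ S ε z y t := rfl
  rw [hcost] at hlim hc
  have hmem : t ∈ argminSet κ S ε z y := ⟨ht, fun r hr => hlim.trans (hD r hr)⟩
  have hval := (le_iSup₂ (f := fun t (_ : t ∈ argminSet κ S ε z y) =>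
    ((Real.exp (kappaHat κ * t) * ((En (S y t)).toReal - (En z).toReal)
        * smoothDistDeriv ε z (S y t)
      - kappaHat κ / 2 * Real.exp (kappaHat κ * t) * smoothDist ε z (S y t) : ℝ) : EReal))
    t hmem).trans_lt hβ
  rw [EReal.coe_lt_coe_iff] at hval
  have hdrift : Tendsto (fun n => flowDrift En κ S ε n (x n) y (s n)) U
      (𝓝 (smoothDistDeriv ε z (S y t) * Real.exp (kappaHat κ * t) * ((En (S y t)).toReal - e)
        - kappaHat κ / 2 * flowCost κ S ε z y t)) := by
    have h1 : Tendsto (fun n => smoothDistDeriv ε (x n) (S y (s n))) U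
        (𝓝 (smoothDistDeriv ε z (S y t))) := by
      simp_rw [smoothDistDeriv_eq hε]
      exact ((continuous_psiDer hε).tendsto _).comp ((hdd.pow 2).div_const 2)
    have h2 : Tendsto (fun n => Real.exp (kappaHat κ * s n)) U
        (𝓝 (Real.exp (kappaHat κ * t))) :=
      (Real.continuous_exp.tendsto _).comp (hst'.const_mul _)
    have h3 : Tendsto (fun n => (En (S y (s n))).toReal) U (𝓝 (En (S y t)).toReal) :=
      (hS.continuousOn_energy hA hy t ht).tendsto.comp hst
    have h4 : Tendsto (fun n : ℕ => max (1 / (n : ℝ)) (flowCost κ S ε (x n) y (s n))) U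
        (𝓝 (flowCost κ S ε z y t)) := by
      have := (tendsto_one_div_atTop_nhds_zero_nat.mono_left hU).max hc
      rwa [max_eq_right (flowCost_pos hε κ S z y t).le] at this
    exact ((h1.mul h2).mul (h3.sub he)).sub (h4.const_mul _)
  have hge := ge_of_tendsto hdrift (hs.mono fun n h => h.2.1.le)
  have hmono : smoothDistDeriv ε z (S y t) * Real.exp (kappaHat κ * t)
        * ((En (S y t)).toReal - e)
      ≤ smoothDistDeriv ε z (S y t) * Real.exp (kappaHat κ * t)
        * ((En (S y t)).toReal - (En z).toReal) := by
    refine mul_le_mul_of_nonneg_left (by linarith) (mul_nonneg ?_ (Real.exp_pos _).le)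
    rw [smoothDistDeriv_eq hε]
    exact (psiDer_pos hε _).le
  rw [flowCost] at hge
  linarith

end Weak

/-! ### The smoothed Tataru distance as a limit -/

section Tataru

variable {E : Type*} [MetricSpace E] {En : E → EReal} {κ : ℝ} {S : E → ℝ → E} {ε : ℝ}

theorem smoothTataru_le (hε : 0 < ε) (x y : E) {t : ℝ} (ht : 0 ≤ t) :
    smoothTataru κ S ε x y ≤ t + flowCost κ S ε x y t := by
  refine ciInf_le (f := fun t : Set.Ici (0 : ℝ) => (t : ℝ) + flowCost κ S ε x y t) ⟨0, ?_⟩ ⟨t, ht⟩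
  rintro _ ⟨s, rfl⟩
  exact add_nonneg s.2 (flowCost_pos hε κ S x y s).le

theorem exists_lt_of_smoothTataru_lt {x y : E} {D : ℝ} (hD : smoothTataru κ S ε x y < D) :
    ∃ t, 0 ≤ t ∧ t + flowCost κ S ε x y t < D := by
  obtain ⟨⟨t, ht⟩, h⟩ := exists_lt_of_ciInf_lt hD
  exact ⟨t, ht, h⟩

/-- The approximation `-(1 / m) log Λ` of the smoothed Tataru distance. -/
noncomputable def softTataru (κ : ℝ) (S : E → ℝ → E) (ε : ℝ) (m : ℕ) (x y : E) : ℝ :=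
  -(Real.log (laplace κ S ε m x y) / m)

theorem f3Dag_eq (a b c : ℝ) (m : ℕ) (ρ μ π : E) :
    f3Dag κ S a b c ε m ρ μ π = a / 2 * dist π ρ ^ 2 + b * softTataru κ S ε m π μ + c := by
  rw [f3Dag, softTataru]
  ring

theorem laplace_pos (hS : IsEVIGradientFlow En κ S) (hε : 0 < ε) (m : ℕ) (x y : E) :
    0 < laplace κ S ε m x y :=
  integral_exp_neg_mul_pos (continuousOn_flowCost hS hε x y)
    (fun t _ => (flowCost_pos hε κ S x y t).le) m

theorem softTataru_le_iff (hS : IsEVIGradientFlow En κ S) (hε : 0 < ε) {m : ℕ} (hm : 1 ≤ m)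
    (x y : E) (D : ℝ) :
    softTataru κ S ε m x y ≤ D ↔ Real.exp (-(m * D)) ≤ laplace κ S ε m x y := by
  have hm1 : (0 : ℝ) < m := by exact_mod_cast hm
  rw [← Real.le_log_iff_exp_le (laplace_pos hS hε m x y), softTataru, neg_le, le_div_iff₀ hm1]
  rw [neg_mul, mul_comm]

theorem eventually_softTataru_le (hS : IsEVIGradientFlow En κ S) (hε : 0 < ε) {x y : E} {D : ℝ}
    (hD : smoothTataru κ S ε x y < D) : ∀ᶠ m : ℕ in atTop, softTataru κ S ε m x y ≤ D := by
  obtain ⟨t, ht, htD⟩ := exists_lt_of_smoothTataru_lt hD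
  filter_upwards [eventually_ge_atTop 1,
    eventually_exp_le_integral_exp_neg_mul (continuousOn_flowCost hS hε x y)
      (fun t _ => (flowCost_pos hε κ S x y t).le) ht htD] with m hm h
  exact (softTataru_le_iff hS hε hm x y D).2 h

/-- The error `log (m + 1) / m` comes from the total mass `m + 1` left after tilting the
exponential law of rate `1`. -/
theorem le_softTataru (hS : IsEVIGradientFlow En κ S) (hε : 0 < ε) {m : ℕ} (hm : 1 ≤ m)
    {x y : E} {q : ℝ} (hq : ∀ t, 0 ≤ t → q ≤ t + flowCost κ S ε x y t) :
    q - Real.log (m + 1) / m ≤ softTataru κ S ε m x y := by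
  have hm1 : (0 : ℝ) < m := by exact_mod_cast hm
  have h : laplace κ S ε m x y ≤ (m + 1) * Real.exp (-(m * q)) :=
    integral_exp_neg_mul_le (continuousOn_flowCost hS hε x y)
      (fun t _ => (flowCost_pos hε κ S x y t).le) m hq
  have h2 := Real.log_le_log (laplace_pos hS hε m x y) h
  rw [Real.log_mul (by positivity) (Real.exp_pos _).ne', Real.log_exp] at h2
  have h3 : Real.log (laplace κ S ε m x y) / m ≤ (Real.log (m + 1) + -(m * q)) / m := by gcongr
  have h4 : (Real.log (m + 1) + -(m * q)) / m = Real.log (m + 1) / m - q := by field_simp; ring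
  rw [softTataru]
  linarith

theorem neg_one_le_softTataru (hS : IsEVIGradientFlow En κ S) (hε : 0 < ε) {m : ℕ} (hm : 1 ≤ m)
    (x y : E) : -1 ≤ softTataru κ S ε m x y := by
  have h1 := le_softTataru hS hε hm (x := x) (y := y) (q := 0)
    (fun t ht => add_nonneg ht (flowCost_pos hε κ S x y t).le)
  have hmpos : (0 : ℝ) < m := by exact_mod_cast hm
  have h2 : Real.log (m + 1) / m ≤ 1 := by
    rw [div_le_one hmpos]
    have := Real.log_le_sub_one_of_pos (by positivity : (0 : ℝ) < m + 1)
    linarith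
  linarith

theorem tendsto_log_add_one_div_nat :
    Tendsto (fun m : ℕ => Real.log ((m : ℝ) + 1) / m) atTop (𝓝 0) := by
  have h1 : Tendsto (fun x : ℝ => Real.log x / (1 * x + -1)) atTop (𝓝 0) := by
    simpa using Real.tendsto_pow_log_div_mul_add_atTop 1 (-1) 1 one_ne_zero
  have h2 : Tendsto (fun m : ℕ => (m : ℝ) + 1) atTop atTop :=
    tendsto_atTop_add_const_right _ _ tendsto_natCast_atTop_atTop
  refine (h1.comp h2).congr fun m => ?_
  simp

end Tataru

/-! ### Limits of nearly optimal points -/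

section Core

variable {E : Type*} [MetricSpace E] {En : E → EReal} {κ : ℝ} {S : E → ℝ → E} {ε : ℝ}
  {τ : TopologicalSpace E}

/-- The average of `flowDrift` against the weights `exp (-m h)`, in the form in which it appears in
the third Hamiltonians. -/
noncomputable def driftAverage (En : E → EReal) (κ : ℝ) (S : E → ℝ → E) (ε : ℝ) (m : ℕ) (x y : E) :
    ℝ :=
  (laplace κ S ε m x y)⁻¹ *
    (laplaceEnergy En κ S ε m x y - kappaHat κ / 2 * laplaceCost κ S ε m x y)

/-- For large `m`, a bound `β` of the drift at the times whose total cost is nearly minimal bounds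
the averaged drift up to a vanishing error, uniformly over points with energy at least `L`. -/
theorem eventually_driftAverage_le (hA : MetricEnergyAssumption En)
    (hS : IsEVIGradientFlow En κ S) (hτ : WeakTopologyAssumption En τ) (hε : 0 < ε) {y : E}
    (hy : En y ≠ ⊤) (L : ℝ) :
    ∃ C, 0 ≤ C ∧ ∀ᶠ m : ℕ in atTop, ∀ x p δ β, L ≤ (En x).toReal → softTataru κ S ε m x y ≤ p →
      (∀ t, 0 ≤ t → t + flowCost κ S ε x y t ≤ p + δ → flowDrift En κ S ε m x y t ≤ β) →
      driftAverage En κ S ε m x y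
        ≤ β + (C + |β|) * Real.exp (p + δ) * ((m + 1) * Real.exp (-(m * δ))) := by
  obtain ⟨C, hC0, hC⟩ := exists_flowDrift_le hA hS hε hy L
  refine ⟨C, hC0, ?_⟩
  filter_upwards [eventually_ge_atTop 1, eventually_integrable_flowDrift hA hS hτ hε hy]
    with m hm hi x p δ β hx hp hβ
  obtain ⟨h1, h2⟩ := hi x
  rw [driftAverage, h2]
  refine (laplace_average_le (continuousOn_flowCost hS hε x y)
    (fun t _ => (flowCost_pos hε κ S x y t).le) hm hC0 h1 hβ (hC m hm x hx)
    ((softTataru_le_iff hS hε hm x y p).1 hp)).trans (le_of_eq ?_)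
  ring

/-- Nearly optimal points for the softened test functions have a weak cluster point which is
optimal for the limiting test function and satisfies the limiting inequality. The dependence of the
Hamiltonian on the distance to `ρ` only enters through a continuous function `Φ`. -/
theorem exists_optimal_point (hA : MetricEnergyAssumption En) (hS : IsEVIGradientFlow En κ S)
    (hτ : WeakTopologyAssumption En τ) (hε : 0 < ε) {a b c lam : ℝ} (ha : 0 < a) (hb : 0 < b)
    (hlam : 0 < lam) {ρ μ : E} (hμ : En μ ≠ ⊤) {u h : E → ℝ}
    (hu : @UpperSemicontinuous E ℝ τ _ u) (hub : ∃ C, ∀ x, |u x| ≤ C)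
    (hh : @Continuous E ℝ τ _ h) (hhb : ∃ C, ∀ x, |h x| ≤ C) {Φ : ℝ → ℝ} (hΦ : Continuous Φ)
    (hseq : ∀ m : ℕ, 1 ≤ m → ∃ x, En x ≠ ⊤ ∧
      (∀ y, u y - f3Dag κ S a b c ε m ρ μ y - 1 / m ≤ u x - f3Dag κ S a b c ε m ρ μ x) ∧
      u x - lam * (a * ((En ρ).toReal - (En x).toReal) + Φ (dist x ρ)
        + b * driftAverage En κ S ε m x μ) - h x ≤ 1 / m) :
    ∃ z, En z ≠ ⊤ ∧
      (∀ y, u y - f4Dag κ S a b c ε ρ μ y ≤ u z - f4Dag κ S a b c ε ρ μ z) ∧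
      ∀ β : ℝ, flowSup En κ S ε z μ < β →
        u z - lam * (a * ((En ρ).toReal - (En z).toReal) + Φ (dist z ρ) + b * β) - h z ≤ 0 := by
  obtain ⟨Cu, hCu⟩ := hub
  obtain ⟨Ch, hCh⟩ := hhb
  have : Nonempty E := ⟨ρ⟩
  choose! x hxt hxopt hxsub using hseq
  have hCu1 := fun w => (abs_le.1 (hCu w)).1
  have hCu2 := fun w => (abs_le.1 (hCu w)).2
  have hCh1 := fun w => (abs_le.1 (hCh w)).1
  have hm1 : ∀ m : ℕ, 1 ≤ m → 1 / (m : ℝ) ≤ 1 := fun m hm =>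
    (div_le_one (by positivity)).2 (by exact_mod_cast hm)
  simp only [f3Dag_eq] at hxopt
  -- coercivity: comparison with `ρ` bounds the distances and the soft Tataru distances
  set Dρ := smoothTataru κ S ε ρ μ
  set P₀ := (2 * Cu + 1 + b * (Dρ + 1)) with hP₀
  have hlow : ∀ m : ℕ, 1 ≤ m → ∀ w, -1 ≤ softTataru κ S ε m w μ := fun m hm w =>
    neg_one_le_softTataru hS hε hm w μ
  have hcoer : ∀ᶠ m : ℕ in atTop,
      a / 2 * dist (x m) ρ ^ 2 + b * softTataru κ S ε m (x m) μ ≤ P₀ := by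
    filter_upwards [eventually_ge_atTop 1,
      eventually_softTataru_le hS hε (lt_add_one Dρ)] with m hm hD
    have h1 := hxopt m hm ρ
    rw [dist_self] at h1
    have h2 := mul_le_mul_of_nonneg_left hD hb.le
    linarith [hCu1 ρ, hCu2 (x m), hm1 m hm]
  set P := P₀ / b with hP
  have hTP : ∀ᶠ m : ℕ in atTop, softTataru κ S ε m (x m) μ ≤ P := by
    filter_upwards [hcoer] with m h1
    rw [hP, le_div_iff₀ hb]
    have : 0 ≤ a / 2 * dist (x m) ρ ^ 2 := by positivity
    linarith
  set R := √(2 * (P₀ + b) / a) with hR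
  have hdR : ∀ᶠ m : ℕ in atTop, dist (x m) ρ ≤ R := by
    filter_upwards [hcoer, eventually_ge_atTop 1] with m h1 hm
    refine Real.le_sqrt_of_sq_le ?_
    rw [le_div_iff₀ ha]
    have := mul_le_mul_of_nonneg_left (hlow m hm (x m)) hb.le
    linarith
  -- the subsolution inequality bounds the energies
  obtain ⟨L, hL⟩ := hτ.exists_le_energy hA ρ R
  have hLx : ∀ᶠ m : ℕ in atTop, L ≤ (En (x m)).toReal := by
    filter_upwards [hdR, eventually_ge_atTop 1] with m h1 hm
    have h2 := hL (x m) h1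
    rw [← EReal.coe_toReal (hxt m hm) (hA.ne_bot _)] at h2
    exact_mod_cast h2
  obtain ⟨C, hC0, hC⟩ := eventually_driftAverage_le hA hS hτ hε hμ L
  obtain ⟨C', hC'0, hC'⟩ := exists_flowDrift_le hA hS hε hμ L
  set β₀ := C' * (1 + (P + 1)) with hβ₀
  have hBbd : ∀ᶠ m : ℕ in atTop, driftAverage En κ S ε m (x m) μ
      ≤ β₀ + (C + |β₀|) * Real.exp (P + 1) * 1 := by
    filter_upwards [hC, hLx, hTP, eventually_ge_atTop 1,
      (tendsto_add_one_mul_exp_neg one_pos).eventually_le_const one_pos] with m h1 h2 h3 hm h4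
    refine (h1 (x m) P 1 β₀ h2 h3 fun t ht hle => ?_).trans (by gcongr)
    refine (hC' m hm (x m) h2 t ht).trans ?_
    rw [hβ₀]
    gcongr
    linarith
  obtain ⟨Q, hQ⟩ := (isCompact_Icc (a := (0 : ℝ)) (b := R)).bddAbove_image hΦ.continuousOn
  set B₀ := β₀ + (C + |β₀|) * Real.exp (P + 1) * 1
  obtain ⟨H, hHx⟩ : ∃ H : ℝ, ∀ᶠ m : ℕ in atTop, (En (x m)).toReal ≤ H := by
    refine ⟨((1 + Cu + Ch) / lam + a * (En ρ).toReal + Q + b * B₀) / a, ?_⟩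
    filter_upwards [hBbd, hdR, eventually_ge_atTop 1] with m h1 h2 hm
    have h3 := hxsub m hm
    have h4 : Φ (dist (x m) ρ) ≤ Q := hQ ⟨_, ⟨dist_nonneg, h2⟩, rfl⟩
    have h5 := mul_le_mul_of_nonneg_left h1 hb.le
    rw [le_div_iff₀ ha]
    have h6 : -(a * ((En ρ).toReal - (En (x m)).toReal) + Φ (dist (x m) ρ)
        + b * driftAverage En κ S ε m (x m) μ) ≤ (1 + Cu + Ch) / lam := by
      rw [le_div_iff₀ hlam]
      linarith [hCu1 (x m), (abs_le.1 (hCh (x m))).2, hm1 m hm]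
    linarith
  -- extraction of a weak cluster point
  set U : Ultrafilter ℕ := Ultrafilter.of atTop
  have hU : (U : Filter ℕ) ≤ atTop := Ultrafilter.of_le _
  obtain ⟨z, ⟨hzR, hzH⟩, hxz⟩ : ∃ z ∈ {w | dist ρ w ≤ R ∧ En w ≤ (H : EReal)},
      Tendsto x U (@nhds E τ z) := by
    refine @IsCompact.ultrafilter_le_nhds E τ _ (hτ.compact ρ R H) (U.map x)
      (le_principal_iff.2 ?_)
    have : ∀ᶠ m in (U : Filter ℕ), x m ∈ {w | dist ρ w ≤ R ∧ En w ≤ (H : EReal)} := by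
      filter_upwards [hU hdR, hU hHx, hU (eventually_ge_atTop 1)] with m h1 h2 hm
      refine ⟨by rwa [dist_comm], ?_⟩
      rw [← EReal.coe_toReal (hxt m hm) (hA.ne_bot _)]
      exact_mod_cast h2
    exact this
  have hzt : En z ≠ ⊤ := (hzH.trans_lt (EReal.coe_lt_top H)).ne
  have hUm : ∀ᶠ m in (U : Filter ℕ), 1 ≤ m := hU (eventually_ge_atTop 1)
  have hUxt : ∀ᶠ m in (U : Filter ℕ), En (x m) ≠ ⊤ := hUm.mono hxt
  obtain ⟨e, -, he⟩ := exists_tendsto_of_mem_Icc U (f := fun m => (En (x m)).toReal)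
    (hU (hLx.and hHx))
  obtain ⟨u₁, -, hu₁⟩ := exists_tendsto_of_mem_Icc U (f := fun m => u (x m)) (l := -Cu) (r := Cu)
    (Eventually.of_forall fun m => ⟨hCu1 _, hCu2 _⟩)
  obtain ⟨d₁, hd₁0, hd₁⟩ := exists_tendsto_of_mem_Icc U (f := fun m => dist (x m) ρ) (l := 0)
    (hU (hdR.mono fun m h => ⟨dist_nonneg, h⟩))
  obtain ⟨T₁, -, hT₁⟩ := exists_tendsto_of_mem_Icc U
    (f := fun m => softTataru κ S ε m (x m) μ) (l := -1)
    (hU (((eventually_ge_atTop 1).and hTP).mono fun m h => ⟨hlow m h.1 _, h.2⟩))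
  set D := smoothTataru κ S ε z μ
  have hDle : ∀ t, 0 ≤ t → D ≤ t + flowCost κ S ε z μ t := fun t ht => smoothTataru_le hε z μ ht
  have hez : (En z).toReal ≤ e :=
    hτ.energy_le_of_tendsto hA hxz (hU hdR) (by rwa [dist_comm]) hzt hUxt he
  have hu₁z : u₁ ≤ u z := by
    refine le_of_forall_gt_imp_ge_of_dense fun q hq => ?_
    exact le_of_tendsto hu₁ ((hxz.eventually (hu z q hq)).mono fun m h => h.le)
  have hd₁z : dist z ρ ≤ d₁ := hτ.dist_le_of_tendsto hxz tendsto_const_nhds hd₁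
  have hT₁z : D ≤ T₁ := by
    refine le_of_forall_lt_imp_le_of_dense fun q hq => ?_
    have h1 := eventually_le_add_flowCost hS hτ hε U hxz (hU hdR) hDle hq
    have h2 := (tendsto_log_add_one_div_nat.mono_left hU).const_sub q
    rw [sub_zero] at h2
    refine le_of_tendsto_of_tendsto h2 hT₁ ?_
    filter_upwards [h1, hUm] with m h3 hm
    exact le_softTataru hS hε hm h3
  have hinv : Tendsto (fun m : ℕ => 1 / (m : ℝ)) U (𝓝 0) :=
    tendsto_one_div_atTop_nhds_zero_nat.mono_left hU
  have hopt : ∀ y, u y - (a / 2 * dist y ρ ^ 2 + b * smoothTataru κ S ε y μ + c)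
      ≤ u₁ - (a / 2 * d₁ ^ 2 + b * T₁ + c) := by
    intro y
    refine le_of_forall_pos_le_add fun q hq => ?_
    have hlim := hu₁.sub ((((hd₁.pow 2).const_mul (a / 2)).add (hT₁.const_mul b)).add_const c)
    have h1 := le_of_tendsto_of_tendsto (hinv.const_sub
      (u y - (a / 2 * dist y ρ ^ 2 + b * (smoothTataru κ S ε y μ + q / b) + c))) hlim (by
        filter_upwards [hUm, hU (eventually_softTataru_le hS hε
          (lt_add_of_pos_right (smoothTataru κ S ε y μ) (div_pos hq hb)))] with m hm h2
        have h3 := mul_le_mul_of_nonneg_left h2 hb.le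
        linarith [hxopt m hm y])
    have h2 : b * (q / b) = q := by field_simp
    rw [mul_add, h2] at h1
    linarith
  -- optimality at `z` itself forces convergence of each term
  have hoz := hopt z
  have hsq : dist z ρ ^ 2 ≤ d₁ ^ 2 := pow_le_pow_left₀ dist_nonneg hd₁z 2
  have hsq' := mul_le_mul_of_nonneg_left hsq (by positivity : 0 ≤ a / 2)
  have hbT := mul_le_mul_of_nonneg_left hT₁z hb.le
  have hu_eq : u₁ = u z := by linarith
  have hd_eq : d₁ = dist z ρ := by
    refine le_antisymm ?_ hd₁z
    have : a / 2 * d₁ ^ 2 ≤ a / 2 * dist z ρ ^ 2 := by linarith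
    exact le_of_sq_le_sq (le_of_mul_le_mul_left this (by positivity)) dist_nonneg
  have hT_eq : T₁ = D := by
    refine le_antisymm ?_ hT₁z
    exact le_of_mul_le_mul_left (by linarith) hb
  rw [hu_eq] at hu₁
  rw [hd_eq] at hd₁
  rw [hT_eq] at hT₁
  refine ⟨z, hzt, fun y => ?_, fun β hβ => ?_⟩
  · have := hopt y
    rw [hu_eq, hd_eq, hT_eq] at this
    exact this
  · obtain ⟨δ, hδ, hδβ⟩ := exists_flowDrift_le_of_flowSup_lt hA hS hτ hε U hU hμ hxz (hU hdR)
      hDle he hez hβ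
    have hBle : ∀ᶠ m in (U : Filter ℕ), driftAverage En κ S ε m (x m) μ
        ≤ β + (C + |β|) * Real.exp (D + δ / 2 + δ / 2)
          * ((m + 1) * Real.exp (-(m * (δ / 2)))) := by
      filter_upwards [hU hC, hU hLx, hδβ,
        hT₁.eventually_le_const (lt_add_of_pos_right D (half_pos hδ))] with m h1 h2 h3 h4
      refine h1 (x m) _ _ β h2 h4 fun t ht hle => h3 t ht ?_
      linarith
    have hhx : Tendsto (fun m => h (x m)) U (𝓝 (h z)) :=
      (@Continuous.tendsto E ℝ τ _ h hh z).comp hxz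
    have hΦx : Tendsto (fun m => Φ (dist (x m) ρ)) U (𝓝 (Φ (dist z ρ))) :=
      (hΦ.tendsto _).comp hd₁
    have herr := (((tendsto_add_one_mul_exp_neg (half_pos hδ)).mono_left hU).const_mul
      ((C + |β|) * Real.exp (D + δ / 2 + δ / 2))).const_add β
    rw [mul_zero, add_zero] at herr
    have hlim := (hu₁.sub (((((he.const_sub (En ρ).toReal).const_mul a).add hΦx).add
      (herr.const_mul b)).const_mul lam)).sub hhx
    have hfin := le_of_tendsto_of_tendsto hlim hinv (by
      filter_upwards [hUm, hBle] with m hm h1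
      have h2 := hxsub m hm
      have h3 := mul_le_mul_of_nonneg_left (mul_le_mul_of_nonneg_left h1 hb.le) hlam.le
      linarith)
    have h4 := mul_le_mul_of_nonneg_left (mul_le_mul_of_nonneg_left hez ha.le) hlam.le
    linarith

end Core

/-! ### Viscosity sub- and supersolutions -/

/-- From a maximising sequence along which the subsolution inequality holds in the limit, a single
nearly optimal point. -/
theorem exists_nearly_optimal {E : Type*} [Nonempty E] {w : E → ℝ} {F : E → EReal} {q : ℝ} (hq : 0 < q)
    (hbd : ∃ C, ∀ y, w y ≤ C) {x : ℕ → E}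
    (hx : Tendsto (fun n => ((w (x n) : ℝ) : EReal)) atTop (𝓝 (⨆ y, ((w y : ℝ) : EReal))))
    (hF : limsup (fun n => F (x n)) atTop ≤ 0) :
    ∃ z, (∀ y, w y - q ≤ w z) ∧ F z < q := by
  obtain ⟨C, hC⟩ := hbd
  have hle : (⨆ y, ((w y : ℝ) : EReal)) ≤ C := iSup_le fun y => by exact_mod_cast hC y
  obtain ⟨y₀⟩ := ‹Nonempty E›
  have hge : ((w y₀ : ℝ) : EReal) ≤ ⨆ y, ((w y : ℝ) : EReal) :=
    le_iSup (fun y => ((w y : ℝ) : EReal)) y₀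
  have hsup := EReal.coe_toReal (hle.trans_lt (EReal.coe_lt_top C)).ne
    ((EReal.bot_lt_coe _).trans_le hge).ne'
  set s := (⨆ y, ((w y : ℝ) : EReal)).toReal
  have h1 : ∀ᶠ n in atTop, ((s - q : ℝ) : EReal) < ((w (x n) : ℝ) : EReal) := by
    refine hx.eventually_const_lt ?_
    rw [← hsup]
    exact_mod_cast sub_lt_self s hq
  have h2 : ∀ᶠ n in atTop, F (x n) < q :=
    eventually_lt_of_limsup_lt (hF.trans_lt (by exact_mod_cast hq))
  obtain ⟨n, h3, h4⟩ := (h1.and h2).exists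
  refine ⟨x n, fun y => ?_, h4⟩
  have h5 : w y ≤ s := by
    have := le_iSup (fun y => ((w y : ℝ) : EReal)) y
    rw [← hsup] at this
    exact_mod_cast this
  have h6 : s - q < w (x n) := by exact_mod_cast h3
  linarith

theorem iSup_coe_neg_eq_neg_iInf {ι : Type*} (f : ι → ℝ) :
    (⨆ i, ((-f i : ℝ) : EReal)) = -⨅ i, ((f i : ℝ) : EReal) := by
  simp only [EReal.coe_neg]
  exact (EReal.negOrderIso.map_iInf fun i => ((f i : ℝ) : EReal)).symm

/-- An inequality known for every real upper bound of `F` passes to `F`, whose value may be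
infinite. -/
theorem sub_le_zero_of_forall_lt {r s G b lam : ℝ} {F : EReal} (hb : 0 < b) (hlam : 0 < lam)
    (H : ∀ β : ℝ, F < β → r - lam * (G + b * β) - s ≤ 0) :
    (r : EReal) - (lam : EReal) * ((G : EReal) + (b : EReal) * F) - (s : EReal) ≤ 0 := by
  induction F with
  | bot =>
    exfalso
    have h1 := H (((r - s - 1) / lam - G) / b) (EReal.bot_lt_coe _)
    field_simp at h1
    linarith
  | coe F =>
    have h2 : r - lam * (G + b * F) - s ≤ 0 := by
      refine le_of_forall_pos_le_add fun q hq => ?_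
      have h1 := H (F + q / (lam * b)) (by exact_mod_cast lt_add_of_pos_right F (by positivity))
      have h3 : lam * (b * (q / (lam * b))) = q := by field_simp
      linarith
    exact_mod_cast h2
  | top =>
    rw [EReal.coe_mul_top_of_pos hb, EReal.coe_add_top, EReal.coe_mul_top_of_pos hlam,
      EReal.sub_top, EReal.bot_sub]
    exact bot_le

theorem zero_le_sub_of_forall_lt {r s G b lam : ℝ} {F : EReal} (hb : 0 < b) (hlam : 0 < lam)
    (H : ∀ β : ℝ, F < β → 0 ≤ r - lam * (G - b * β) - s) :
    0 ≤ (r : EReal) - (lam : EReal) * ((G : EReal) - (b : EReal) * F) - (s : EReal) := by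
  have h := sub_le_zero_of_forall_lt (r := -r) (s := -s) (G := -G) hb hlam
    (F := F) fun β hβ => by linarith [H β hβ]
  induction F with
  | bot =>
    exfalso
    have h1 := H (((-r + s - 1) / lam + G) / b) (EReal.bot_lt_coe _)
    field_simp at h1
    linarith
  | coe F =>
    norm_cast at h ⊢
    linarith
  | top =>
    rw [EReal.coe_mul_top_of_pos hb, EReal.sub_top, EReal.coe_mul_bot_of_pos hlam]
    simp

section Viscosity

variable {E : Type*} [MetricSpace E] {En : E → EReal} {κ : ℝ} {S : E → ℝ → E} {ε : ℝ}

theorem energy_ne_top_of_information_add_lt {x y : E}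
    (h : information En x + information En y < ⊤) : En y ≠ ⊤ := by
  intro hy
  rw [show information En y = ⊤ by simp [information, hy]] at h
  simp at h

theorem exists_forall_abs_le (h : BoundedContinuousFunction E ℝ) : ∃ C, ∀ x, |h x| ≤ C :=
  ⟨‖h‖, h.norm_coe_le_norm⟩

theorem f3Dag_ge (hS : IsEVIGradientFlow En κ S) (hε : 0 < ε) {a b : ℝ} (ha : 0 < a) (hb : 0 < b)
    (c : ℝ) {m : ℕ} (hm : 1 ≤ m) (ρ μ x : E) : c - b ≤ f3Dag κ S a b c ε m ρ μ x := by
  have h := neg_one_le_softTataru hS hε hm x μ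
  have := mul_le_mul_of_nonneg_left h hb.le
  have h2 : 0 ≤ a / 2 * dist x ρ ^ 2 := by positivity
  rw [f3Dag_eq]
  linarith

theorem isViscositySubsolution_H4Dag {τ : TopologicalSpace E} (hA : MetricEnergyAssumption En)
    (hS : IsEVIGradientFlow En κ S) (hτ : WeakTopologyAssumption En τ) {lam : ℝ} (hlam : 0 < lam)
    {u h : E → ℝ} (hu : @UpperSemicontinuous E ℝ τ _ u) (hh : @Continuous E ℝ τ _ h)
    (hhb : ∃ C, ∀ x, |h x| ≤ C) (hsub : IsViscositySubsolution (H3Dag En κ S) lam h u) :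
    IsViscositySubsolution (H4Dag En κ S) lam h u := by
  refine ⟨hsub.bounded, hsub.usc, ?_⟩
  rintro _ ⟨ρ, μ, a, b, ε, c, hI, ha, hb, hε, rfl⟩
  have hμ := energy_ne_top_of_information_add_lt hI
  have : Nonempty E := ⟨ρ⟩
  obtain ⟨C, hC⟩ := hsub.bounded
  obtain ⟨z, hzt, hopt, hz⟩ := exists_optimal_point (c := c) (u := u)
    (Φ := fun r => -(a * (κ / 2) * r ^ 2) + a ^ 2 / 2 * r ^ 2 + a * b * r + b ^ 2 / 2)
    (ρ := ρ) hA hS hτ hε ha hb hlam hμ hu hsub.bounded hh hhb (by fun_prop) (by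
      intro m hm
      obtain ⟨x, hx1, hx2⟩ := hsub.sub _ ⟨ρ, μ, a, b, ε, c, m, hI, ha, hb, hε, hm, rfl⟩
      obtain ⟨z, hz1, hz2⟩ := exists_nearly_optimal (q := 1 / (m : ℝ))
        (w := fun y => u y - f3Dag κ S a b c ε m ρ μ y)
        (F := fun y => (u y : EReal) - (lam : EReal) * g3Dag En κ S a b ε m ρ μ y - (h y : EReal))
        (by positivity)
        ⟨C + b - c, fun y => by
          linarith [f3Dag_ge hS hε ha hb c hm ρ μ y, (abs_le.1 (hC y)).2]⟩ hx1 hx2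
      have hzt : En z ≠ ⊤ := by
        intro hzt
        rw [g3Dag, if_pos hzt, EReal.coe_mul_bot_of_pos hlam, EReal.coe_sub_bot,
          EReal.top_sub_coe] at hz2
        exact not_top_lt hz2
      refine ⟨z, hzt, hz1, ?_⟩
      rw [g3Dag, if_neg hzt] at hz2
      norm_cast at hz2
      rw [driftAverage]
      linarith)
  refine ⟨fun _ => z, ?_, ?_⟩
  · have : (⨆ y, ((u y - f4Dag κ S a b c ε ρ μ y : ℝ) : EReal))
        = ((u z - f4Dag κ S a b c ε ρ μ z : ℝ) : EReal) :=
      le_antisymm (iSup_le fun y => EReal.coe_le_coe_iff.2 (hopt y))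
        (le_iSup (fun y => ((u y - f4Dag κ S a b c ε ρ μ y : ℝ) : EReal)) z)
    simp only [this]
    exact tendsto_const_nhds
  · rw [limsup_const]
    simp only [g4Dag, if_neg hzt]
    exact sub_le_zero_of_forall_lt hb hlam fun β hβ => by linarith [hz β hβ]

theorem isViscositySupersolution_H4Ddag {τ : TopologicalSpace E} (hA : MetricEnergyAssumption En)
    (hS : IsEVIGradientFlow En κ S) (hτ : WeakTopologyAssumption En τ) {lam : ℝ} (hlam : 0 < lam)
    {v h : E → ℝ} (hv : @LowerSemicontinuous E ℝ τ _ v) (hh : @Continuous E ℝ τ _ h)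
    (hhb : ∃ C, ∀ x, |h x| ≤ C) (hsuper : IsViscositySupersolution (H3Ddag En κ S) lam h v) :
    IsViscositySupersolution (H4Ddag En κ S) lam h v := by
  refine ⟨hsuper.bounded, hsuper.lsc, ?_⟩
  rintro _ ⟨γ, π, a, b, ε, c, hI, ha, hb, hε, rfl⟩
  have hπ := energy_ne_top_of_information_add_lt hI
  have : Nonempty E := ⟨γ⟩
  obtain ⟨C, hC⟩ := hsuper.bounded
  have hf3 : ∀ m y, f3Ddag κ S a b c ε m γ π y = -f3Dag κ S a b (-c) ε m γ π y := by
    intro m y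
    rw [f3Ddag, f3Dag, dist_comm γ]
    ring
  have hf4 : ∀ y, f4Ddag κ S a b c ε γ π y = -f4Dag κ S a b (-c) ε γ π y := by
    intro y
    rw [f4Ddag, f4Dag, dist_comm γ]
    ring
  obtain ⟨z, hzt, hopt, hz⟩ := exists_optimal_point (c := -c) (u := fun y => -v y)
    (h := fun y => -h y)
    (Φ := fun r => -(a * (κ / 2) * r ^ 2) - a ^ 2 / 2 * r ^ 2 + a * b * r + b ^ 2 / 2)
    (ρ := γ) hA hS hτ hε ha hb hlam hπ (fun x q hq => by
        filter_upwards [hv x (-q) (neg_lt.1 hq)] with y hy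
        exact neg_lt.1 hy) ⟨C, fun y => by rw [abs_neg]; exact hC y⟩
      hh.neg (by simpa only [abs_neg] using hhb) (by fun_prop) (by
      intro m hm
      obtain ⟨x, hx1, hx2⟩ := hsuper.super _ ⟨γ, π, a, b, ε, c, m, hI, ha, hb, hε, hm, rfl⟩
      simp only [hf3] at hx1
      obtain ⟨z, hz1, hz2⟩ := exists_nearly_optimal (q := 1 / (m : ℝ)) (x := x)
        (w := fun y => -(v y - -f3Dag κ S a b (-c) ε m γ π y))
        (F := fun y => -((v y : EReal) - (lam : EReal) * g3Ddag En κ S a b ε m γ π y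
          - (h y : EReal)))
        (by positivity)
        ⟨C + b + c, fun y => by
          linarith [f3Dag_ge hS hε ha hb (-c) hm γ π y, (abs_le.1 (hC y)).1]⟩
        (by
          rw [iSup_coe_neg_eq_neg_iInf]
          simp only [EReal.coe_neg (_ - _)]
          exact (continuous_neg.tendsto _).comp hx1)
        (by
          have := EReal.limsup_neg (f := atTop) (v := fun n => (v (x n) : EReal)
            - (lam : EReal) * g3Ddag En κ S a b ε m γ π (x n) - (h (x n) : EReal))
          refine this.trans_le ?_
          rw [EReal.neg_le, neg_zero]
          exact hx2)
      have hzt : En z ≠ ⊤ := by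
        intro hzt
        rw [g3Ddag, if_pos hzt, EReal.coe_mul_top_of_pos hlam, EReal.sub_top,
          EReal.bot_sub, EReal.neg_bot] at hz2
        exact not_top_lt hz2
      refine ⟨z, hzt, fun y => by linarith [hz1 y], ?_⟩
      rw [g3Ddag, if_neg hzt] at hz2
      norm_cast at hz2
      rw [driftAverage]
      linarith)
  refine ⟨fun _ => z, ?_, ?_⟩
  · have : (⨅ y, ((v y - f4Ddag κ S a b c ε γ π y : ℝ) : EReal))
        = ((v z - f4Ddag κ S a b c ε γ π z : ℝ) : EReal) :=
      le_antisymm (iInf_le (fun y => ((v y - f4Ddag κ S a b c ε γ π y : ℝ) : EReal)) z)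
        (le_iInf fun y => EReal.coe_le_coe_iff.2 (by rw [hf4, hf4]; linarith [hopt y]))
    simp only [this]
    exact tendsto_const_nhds
  · rw [liminf_const]
    simp only [g4Ddag, if_neg hzt, dist_comm γ]
    exact zero_le_sub_of_forall_lt hb hlam fun β hβ => by linarith [hz β hβ]

end Viscosity

end TataruHJ

theorem theorem5p8 {E : Type*} [MetricSpace E] [CompleteSpace E] (h : BoundedContinuousFunction E ℝ)
    (En : E → EReal) (κ : ℝ) (S : E → ℝ → E) (lam : ℝ) (hlam : 0 < lam)
    (hEn : TataruHJ.MetricEnergyAssumption En) (hS : TataruHJ.IsEVIGradientFlow En κ S)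
    (τ : TopologicalSpace E) (hτ : TataruHJ.WeakTopologyAssumption En τ)
    (hh : @Continuous E ℝ τ _ h) :
    (∀ u : E → ℝ, @UpperSemicontinuous E ℝ τ _ u →
      TataruHJ.IsViscositySubsolution (TataruHJ.H3Dag En κ S) lam h u →
      TataruHJ.IsViscositySubsolution (TataruHJ.H4Dag En κ S) lam h u) ∧
    (∀ v : E → ℝ, @LowerSemicontinuous E ℝ τ _ v →
      TataruHJ.IsViscositySupersolution (TataruHJ.H3Ddag En κ S) lam h v →
      TataruHJ.IsViscositySupersolution (TataruHJ.H4Ddag En κ S) lam h v) := by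
  have hhb := TataruHJ.exists_forall_abs_le h
  exact ⟨fun u hu => TataruHJ.isViscositySubsolution_H4Dag hEn hS hτ hlam hu hh hhb,
    fun v hv => TataruHJ.isViscositySupersolution_H4Ddag hEn hS hτ hlam hv hh hhb⟩
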